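/- Let $(N,\gamma)$ be a closed (compact, without boundary) smooth $n$-manifold with a Riemannian metric $\gamma$ of class $C^1$ (for instance the boundary $\partial M$ of a compact oriented manifold $M$), and let $dV_\gamma$ be its Riemannian volume measure. For a Riemannian metric $g$ and a $(0,2)$-tensor $\tau$ let $\delta_g\tau=-\operatorname{tr}_g\nabla^g\tau$, i.e. $(\delta_g\tau)_j=-g^{ki}\nabla^g_k\tau_{ij}$, be the divergence of $\tau$, a 1-form ($\nabla^g$ is the Levi-Civita connection). Let $X$ be a Killing field of $\gamma$ ($\mathcal L_X\gamma=0$) of class $C^1$, and let $\tau$ be a symmetric bilinear form of class $C^1$ on $N$ with $\delta_\gamma\tau=0$. Then for every symmetric bilinear form $h$ of class $C^1$ on $N$ the variation $\delta'_h\tau=\frac{d}{ds}\big|_{s=0}\delta_{\gamma+sh}\tau$ exists at each point, the functions $\langle\mathcal L_X\tau,h\rangle_\gamma$ and $\langle\delta'_h\tau,X\rangle=(\delta'_h\tau)(X)$ are integrable, and $$\int_N\langle\mathcal L_X\tau,h\rangle_\gamma\,dV_\gamma=-2\int_N\langle\delta'_h\tau,X\rangle\,dV_\gamma .$$ -/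

import Mathlib

open Set Filter Topology MeasureTheory
open scoped Manifold ContDiff Matrix

noncomputable section

namespace ClosedRiemannian

/-- The model space `ℝⁿ`. -/
abbrev Model (n : ℕ) : Type := EuclideanSpace ℝ (Fin n)

/-- The tangent space of `M` at `y`. -/
abbrev Tan (n : ℕ) {M : Type*} [TopologicalSpace M] [ChartedSpace (Model n) M] (y : M) : Type :=
  TangentSpace 𝓘(ℝ, Model n) y

/-- A (not necessarily continuous) field of bilinear forms on `M`, that is, a `(0,2)`-tensor. -/
abbrev BilinField (n : ℕ) (M : Type*) [TopologicalSpace M] [ChartedSpace (Model n) M] :=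
  ∀ y : M, Tan n y →L[ℝ] Tan n y →L[ℝ] ℝ

/-- A (not necessarily continuous) vector field on `M`. -/
abbrev VecField (n : ℕ) (M : Type*) [TopologicalSpace M] [ChartedSpace (Model n) M] :=
  ∀ y : M, Tan n y

section Defs

variable {n : ℕ} {M : Type*} [TopologicalSpace M] [ChartedSpace (Model n) M]
  [IsManifold 𝓘(ℝ, Model n) ∞ M]

/-- A field of bilinear forms of class `C¹`, as a section of the bundle `Hom(TM, Hom(TM, ℝ))`. -/
def BilinField.IsC1 (τ : BilinField n M) : Prop :=
  ContMDiff 𝓘(ℝ, Model n) (𝓘(ℝ, Model n).prod 𝓘(ℝ, Model n →L[ℝ] Model n →L[ℝ] ℝ)) 1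
    (fun y : M => Bundle.TotalSpace.mk' (Model n →L[ℝ] Model n →L[ℝ] ℝ)
      (E := fun y : M => Tan n y →L[ℝ] Tan n y →L[ℝ] ℝ) y (τ y))

/-- A vector field of class `C¹`. -/
def VecField.IsC1 (X : VecField n M) : Prop :=
  ContMDiff 𝓘(ℝ, Model n) 𝓘(ℝ, Model n).tangent 1
    (fun y : M => (⟨y, X y⟩ : TangentBundle 𝓘(ℝ, Model n) M))

/-- Symmetry of a field of bilinear forms. -/
def BilinField.IsSymm (τ : BilinField n M) : Prop :=
  ∀ (y : M) (u v : Tan n y), τ y u v = τ y v u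

/-! Coordinates. Below, `x` selects the preferred chart of `M` at `x`, `y` is a point of the domain
of this chart and `p` a point of its image in `ℝⁿ`. -/

/-- The coordinate vector `∂ᵢ` at `y`, for the chart selected by `x`. -/
def coordVec (x y : M) (i : Fin n) : Tan n y :=
  (trivializationAt (Model n) (TangentSpace 𝓘(ℝ, Model n)) x).symmL ℝ y
    (EuclideanSpace.single i (1 : ℝ))

/-- The coordinate covector `dxⁱ` at `y`, for the chart selected by `x`. -/
def coordCovec (x y : M) (i : Fin n) : Tan n y →L[ℝ] ℝ :=
  (EuclideanSpace.proj i : Model n →L[ℝ] ℝ).comp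
    ((trivializationAt (Model n) (TangentSpace 𝓘(ℝ, Model n)) x).continuousLinearMapAt ℝ y)

/-- The point of `M` with coordinates `p`. -/
def point (x : M) (p : Model n) : M := (extChartAt 𝓘(ℝ, Model n) x).symm p

/-- The coordinates of the point `x`, in the chart selected by `x` itself. -/
def coords (x : M) : Model n := extChartAt 𝓘(ℝ, Model n) x x

/-- The matrix of components `τᵢⱼ = τ(∂ᵢ, ∂ⱼ)`, as a function of the coordinates `p`. -/
def comps (τ : BilinField n M) (x : M) (p : Model n) : Matrix (Fin n) (Fin n) ℝ :=
  Matrix.of fun i j => τ (point x p) (coordVec x (point x p) i) (coordVec x (point x p) j)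

/-- The components `Xⁱ = dxⁱ(X)`, as functions of the coordinates `p`. -/
def vecComps (X : VecField n M) (x : M) (p : Model n) (i : Fin n) : ℝ :=
  coordCovec x (point x p) i (X (point x p))

/-- The partial derivative `∂ₖ f` at `p` of a function of the coordinates. -/
def partialDeriv (k : Fin n) (f : Model n → ℝ) (p : Model n) : ℝ :=
  fderiv ℝ f p (EuclideanSpace.single k (1 : ℝ))

/-- The Christoffel symbols of the Levi-Civita connection of `g`:
`Γˡᵢₖ = ½ ∑ₘ gˡᵐ (∂ᵢ gₘₖ + ∂ₖ gᵢₘ - ∂ₘ gᵢₖ)`. -/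
def christoffel (g : BilinField n M) (x : M) (p : Model n) (l i k : Fin n) : ℝ :=
  (1 / 2) * ∑ m, (comps g x p)⁻¹ l m *
    (partialDeriv i (fun q => comps g x q m k) p + partialDeriv k (fun q => comps g x q i m) p
      - partialDeriv m (fun q => comps g x q i k) p)

/-- The components of the covariant derivative of `τ` for the Levi-Civita connection of `g`:
`∇ₖ τᵢⱼ = ∂ₖ τᵢⱼ - ∑ₗ Γˡₖᵢ τₗⱼ - ∑ₗ Γˡₖⱼ τᵢₗ`. -/
def covDerivComps (g τ : BilinField n M) (x : M) (p : Model n) (k i j : Fin n) : ℝ :=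
  partialDeriv k (fun q => comps τ x q i j) p
    - ∑ l, christoffel g x p l k i * comps τ x p l j
    - ∑ l, christoffel g x p l k j * comps τ x p i l

/-- The components `(δ_g τ)ⱼ = - ∑ gᵏⁱ ∇ₖ τᵢⱼ` of the divergence. -/
def divergenceComps (g τ : BilinField n M) (x : M) (p : Model n) (j : Fin n) : ℝ :=
  - ∑ k, ∑ i, (comps g x p)⁻¹ k i * covDerivComps g τ x p k i j

/-- The divergence `δ_g τ = - tr_g ∇τ` of a `(0,2)`-tensor `τ` with respect to a metric `g`, a
1-form. With this sign `δ_g` is the formal adjoint of `δ_g^* X = ½ L_X g`. The components at `x`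
are computed in the preferred chart at `x`. -/
def divergence (g τ : BilinField n M) (x : M) : Tan n x →L[ℝ] ℝ :=
  ∑ j, divergenceComps g τ x (coords x) j • coordCovec x x j

/-- The components of the Lie derivative:
`(L_X τ)ᵢⱼ = ∑ₖ (Xᵏ ∂ₖ τᵢⱼ + τₖⱼ ∂ᵢ Xᵏ + τᵢₖ ∂ⱼ Xᵏ)`. -/
def lieDerivComps (X : VecField n M) (τ : BilinField n M) (x : M) (p : Model n) (i j : Fin n) : ℝ :=
  ∑ k, (vecComps X x p k * partialDeriv k (fun q => comps τ x q i j) p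
    + comps τ x p k j * partialDeriv i (fun q => vecComps X x q k) p
    + comps τ x p i k * partialDeriv j (fun q => vecComps X x q k) p)

/-- The Lie derivative `L_X τ` of a `(0,2)`-tensor along a vector field. -/
def lieDeriv (X : VecField n M) (τ : BilinField n M) : BilinField n M := fun x =>
  ∑ i, ∑ j, lieDerivComps X τ x (coords x) i j • (coordCovec x x i).smulRight (coordCovec x x j)

/-- The inner product of `(0,2)`-tensors at `x`:
`⟨a, b⟩_g = ∑ gⁱᵏ gʲˡ aᵢⱼ bₖₗ`. -/
def tensorInner (g a b : BilinField n M) (x : M) : ℝ :=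
  ∑ i, ∑ j, ∑ k, ∑ l, (comps g x (coords x))⁻¹ i k * (comps g x (coords x))⁻¹ j l *
    comps a x (coords x) i j * comps b x (coords x) k l

/-- The pairing `⟨δ'_h τ, X⟩` at `x`, where `δ'_h τ = d/ds δ_{γ + s h} τ` at `s = 0` and `v = X(x)`:
the derivative at `s = 0` of the number `(δ_{γ + s h} τ)(v)`. -/
def divVariation (γ h τ : BilinField n M) (x : M) (v : Tan n x) : ℝ :=
  deriv (fun s : ℝ => divergence (fun y => γ y + s • h y) τ x v) 0

/-- `X` is a Killing field of the metric `γ`: `L_X γ = 0`. -/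
def IsKilling (γ : BilinField n M) (X : VecField n M) : Prop :=
  ∀ x, lieDeriv X γ x = 0

/-- `τ` is divergence-free with respect to the metric `γ`: `δ_γ τ = 0`. -/
def IsDivFree (γ τ : BilinField n M) : Prop :=
  ∀ x, divergence γ τ x = 0

variable [MeasurableSpace M]

/-- The measure `√(det g) dp` of a metric `g` on the domain of the chart selected by `x`,
as a measure on `M` (zero off that domain). -/
def chartVolume (g : BilinField n M) (x : M) : Measure M :=
  ((volume.restrict (extChartAt 𝓘(ℝ, Model n) x).target).withDensity
    (fun p => ENNReal.ofReal (Real.sqrt (comps g x p).det))).map (point x)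

/-- The Riemannian volume measure `dV_g`. On the domain of each chart it is `√(det g) dp`; as these
measures agree on overlaps, it is the smallest measure which dominates all of them. -/
def riemannianVolume (g : BilinField n M) : Measure M :=
  ⨆ x : M, chartVolume g x

end Defs

/-- A Riemannian metric of class `C¹` on `M`. -/
abbrev Metric (n : ℕ) (M : Type*) [TopologicalSpace M] [ChartedSpace (Model n) M]
    [IsManifold 𝓘(ℝ, Model n) ∞ M] :=
  Bundle.ContMDiffRiemannianMetric 𝓘(ℝ, Model n) 1 (Model n) (fun y : M => Tan n y)

end ClosedRiemannian

end

/-! Let `S` and `K` be the endomorphisms that `γ` associates with `τ` and `h`. For any metric `g`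
the symmetry of `τ` gives `(δ_g τ)(X) = -div_g(S_g X) + ½⟨τ, L_X g⟩_g`, where `S_g` is the
endomorphism of `τ` for `g`. Differentiate along `g = γ + s h`: `S` varies by `-KS`, the volume
density by the factor `½ tr K`, and `L_X g` by `L_X h`. Since `δ_γ τ = 0` and `L_X γ = 0`, what
remains is `2⟨δ'_h τ, X⟩ = div(2KSX - tr(K) SX) + ⟨τ, L_X h⟩`. As `X` is Killing, also `⟨L_X τ, h⟩ +
⟨τ, L_X h⟩ = X⟨τ, h⟩ = div(⟨τ, h⟩ X)`. Adding the two identities eliminates `L_X h`: the field `Z =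
⟨τ, h⟩ X + 2KSX - tr(K) SX` satisfies `div Z = ⟨L_X τ, h⟩ + 2⟨δ'_h τ, X⟩`, and the divergence
theorem on the closed manifold finishes the proof.

The pointwise identity is pure matrix algebra, `matrixInner_lieMatrix_fluxVec`, checked in a single
chart at each point. Since `Z` depends algebraically on `γ`, `τ`, `h`, `X`, it is of class C¹, and
only first derivatives of the data ever occur.

Divergence is encoded as `2 div Z = ⟨L_Z γ, γ⟩`. Both `⟨L_X τ, h⟩` and `div Z` are then instances of
one scalar, whose independence of the chart rests on `lieMatrix_congruence`; the transformation law
of Christoffel symbols is never needed. `riemannianVolume_restrict` and a partition of unity reduce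
the divergence theorem to integration by parts in `ℝⁿ`. -/

noncomputable section

namespace ClosedRiemannian

/-! ### Component formulas at a point: Lie derivative, Christoffel contractions, divergence. -/

section MatrixAlgebra

variable {n : ℕ}

/-- The Lie derivative of a bilinear form with matrix `T` and partial derivatives `Tk`, along a
vector field with components `X` and Jacobian matrix `J`. -/
def lieMatrix (T : Matrix (Fin n) (Fin n) ℝ) (Tk : Fin n → Matrix (Fin n) (Fin n) ℝ)
    (X : Fin n → ℝ) (J : Matrix (Fin n) (Fin n) ℝ) : Matrix (Fin n) (Fin n) ℝ :=
  ∑ k, X k • Tk k + Jᵀ * T + T * J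

/-- The inner product of bilinear forms with matrices `A`, `B`, for the inverse metric `P`. -/
def matrixInner (P A B : Matrix (Fin n) (Fin n) ℝ) : ℝ := (Pᵀ * A * P * Bᵀ).trace

/-- The Christoffel symbols, for the inverse metric `P` and the partial derivatives `Gk` of the
metric. -/
def christoffelSymbol (P : Matrix (Fin n) (Fin n) ℝ) (Gk : Fin n → Matrix (Fin n) (Fin n) ℝ)
    (l i k : Fin n) : ℝ :=
  (1 / 2) * ∑ m, P l m * (Gk i m k + Gk k i m - Gk m i k)

/-- The divergence of a symmetric bilinear form, contracted with a vector. -/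
def divergenceForm (P : Matrix (Fin n) (Fin n) ℝ) (Gk : Fin n → Matrix (Fin n) (Fin n) ℝ)
    (T : Matrix (Fin n) (Fin n) ℝ) (Tk : Fin n → Matrix (Fin n) (Fin n) ℝ) (v : Fin n → ℝ) : ℝ :=
  -∑ k, (((P * Tk k) *ᵥ v) k - ((P * Gk k * P * T) *ᵥ v) k
    + (1 / 2) * ((P * Gk k).trace * ((P * T) *ᵥ v) k) - (1 / 2) * (v k * (P * T * P * Gk k).trace))

theorem matrixInner_eq_sum (P A B : Matrix (Fin n) (Fin n) ℝ) :
    matrixInner P A B = ∑ i, ∑ j, ∑ k, ∑ l, P i k * P j l * A i j * B k l := by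
  have h1 : matrixInner P A B = ∑ k, ∑ l, ∑ j, ∑ i, P i k * P j l * A i j * B k l := by
    simp only [matrixInner, Matrix.trace, Matrix.diag, Matrix.mul_apply, Matrix.transpose_apply,
      Finset.sum_mul]
    refine Finset.sum_congr rfl fun k _ => Finset.sum_congr rfl fun l _ =>
      Finset.sum_congr rfl fun j _ => Finset.sum_congr rfl fun i _ => by ring
  rw [h1]
  have h2 : ∀ k, ∑ l, ∑ j, ∑ i, P i k * P j l * A i j * B k l
      = ∑ i, ∑ j, ∑ l, P i k * P j l * A i j * B k l := fun k => by
    rw [Finset.sum_comm]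
    simp_rw [Finset.sum_comm (s := (Finset.univ : Finset (Fin n))) (t := Finset.univ)
      (f := fun l i => P i k * P _ l * A i _ * B k l)]
    rw [Finset.sum_comm]
  simp_rw [h2]
  rw [Finset.sum_comm]
  refine Finset.sum_congr rfl fun i _ => ?_
  rw [Finset.sum_comm]

/-- Contraction with the symmetric `P` identifies the first two of the three derivative terms of
`Γ`; the third becomes a trace. -/
theorem sum_mul_christoffelSymbol_trace {P : Matrix (Fin n) (Fin n) ℝ}
    {Gk : Fin n → Matrix (Fin n) (Fin n) ℝ} (hP : P.IsSymm) (hG : ∀ k, (Gk k).IsSymm) (l : Fin n) :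
    ∑ k, ∑ i, P k i * christoffelSymbol P Gk l k i =
      ∑ k, (P * Gk k * P) k l - (1 / 2) * ∑ m, (P * Gk m).trace * P m l := by
  have e1 : ∑ k, ∑ i, P k i * christoffelSymbol P Gk l k i =
      (1 / 2) * (∑ k, ∑ i, ∑ m, P k i * Gk k i m * P m l + ∑ k, ∑ i, ∑ m, P k i * Gk i k m * P m l
        - ∑ k, ∑ i, ∑ m, P k i * Gk m k i * P m l) := by
    simp only [christoffelSymbol, Finset.mul_sum, ← Finset.sum_add_distrib, ← Finset.sum_sub_distrib]
    refine Finset.sum_congr rfl fun k _ => Finset.sum_congr rfl fun i _ =>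
      Finset.sum_congr rfl fun m _ => ?_
    rw [hP.apply m l, (hG k).apply i m]; ring
  have e2 : ∑ k, ∑ i, ∑ m, P k i * Gk i k m * P m l = ∑ k, ∑ i, ∑ m, P k i * Gk k i m * P m l := by
    rw [Finset.sum_comm]
    refine Finset.sum_congr rfl fun k _ => Finset.sum_congr rfl fun i _ =>
      Finset.sum_congr rfl fun m _ => ?_
    rw [hP.apply k i]
  have e3 : ∑ k, ∑ i, ∑ m, P k i * Gk k i m * P m l = ∑ k, (P * Gk k * P) k l := by
    refine Finset.sum_congr rfl fun k _ => ?_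
    simp only [Matrix.mul_apply, Finset.sum_mul]
    rw [Finset.sum_comm]
  have e4 : ∑ k, ∑ i, ∑ m, P k i * Gk m k i * P m l = ∑ m, (P * Gk m).trace * P m l := by
    simp only [Matrix.mul_apply, Matrix.trace, Matrix.diag, Finset.sum_mul]
    rw [Finset.sum_comm]
    simp_rw [Finset.sum_comm (s := (Finset.univ : Finset (Fin n))) (t := Finset.univ)
      (f := fun k m => P k _ * Gk m k _ * P m l)]
    rw [Finset.sum_comm]
    refine Finset.sum_congr rfl fun m _ => ?_
    rw [Finset.sum_comm]
    refine Finset.sum_congr rfl fun k _ => Finset.sum_congr rfl fun i _ => ?_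
    rw [(hG m).apply i k]
  rw [e1, e2, e3, e4]; ring

/-- Here `Γ` is contracted with the symmetric matrix `P T P`, so the two terms antisymmetric in the
contracted indices cancel and only the derivative `Gk j` in the free direction survives. -/
theorem sum_mul_christoffelSymbol_mul {P T : Matrix (Fin n) (Fin n) ℝ}
    {Gk : Fin n → Matrix (Fin n) (Fin n) ℝ} (hP : P.IsSymm) (hT : T.IsSymm)
    (hG : ∀ k, (Gk k).IsSymm) (j : Fin n) :
    ∑ k, ∑ i, P k i * ∑ l, christoffelSymbol P Gk l k j * T i l =
      (1 / 2) * (P * T * P * Gk j).trace := by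
  have hQ : (P * T * P).IsSymm := by
    rw [Matrix.IsSymm, Matrix.transpose_mul, Matrix.transpose_mul, hP, hT, Matrix.mul_assoc]
  have e1 : ∑ k, ∑ i, P k i * ∑ l, christoffelSymbol P Gk l k j * T i l =
      (1 / 2) * ∑ k, ∑ m, (P * T * P) k m * (Gk k m j + Gk j k m - Gk m k j) := by
    simp only [christoffelSymbol, Finset.mul_sum, Matrix.mul_apply, Finset.sum_mul]
    refine Finset.sum_congr rfl fun k _ => ?_
    rw [Finset.sum_comm]
    simp_rw [Finset.sum_comm (s := (Finset.univ : Finset (Fin n))) (t := Finset.univ)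
      (f := fun i m => P k i * (1 / 2 * (P _ m * (Gk k m j + Gk j k m - Gk m k j)) * T i _))]
    rw [Finset.sum_comm]
    refine Finset.sum_congr rfl fun m _ => Finset.sum_congr rfl fun l _ =>
      Finset.sum_congr rfl fun i _ => by ring
  have e2 : ∑ k, ∑ m, (P * T * P) k m * Gk m k j = ∑ k, ∑ m, (P * T * P) k m * Gk k m j := by
    rw [Finset.sum_comm]
    refine Finset.sum_congr rfl fun k _ => Finset.sum_congr rfl fun m _ => ?_
    rw [hQ.apply k m]
  have e3 : ∑ k, ∑ m, (P * T * P) k m * Gk j k m = (P * T * P * Gk j).trace := by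
    simp only [Matrix.trace, Matrix.diag, Matrix.mul_apply (M := P * T * P)]
    refine Finset.sum_congr rfl fun k _ => Finset.sum_congr rfl fun m _ => ?_
    rw [(hG j).apply m k]
  rw [e1, ← e3]
  simp only [mul_sub, mul_add, Finset.sum_add_distrib, Finset.sum_sub_distrib, e2]
  ring

/-- Removes the Christoffel symbols: the metric enters only through products of `P` and `Gk`, which
are easy to differentiate in the metric. Invertibility plays no role; symmetry is enough. -/
theorem sum_divergence_eq_divergenceForm {P T : Matrix (Fin n) (Fin n) ℝ}
    {Gk Tk : Fin n → Matrix (Fin n) (Fin n) ℝ} (hP : P.IsSymm) (hT : T.IsSymm)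
    (hG : ∀ k, (Gk k).IsSymm) (v : Fin n → ℝ) :
    ∑ j, (-∑ k, ∑ i, P k i * (Tk k i j - ∑ l, christoffelSymbol P Gk l k i * T l j
      - ∑ l, christoffelSymbol P Gk l k j * T i l)) * v j = divergenceForm P Gk T Tk v := by
  have hj : ∀ j, ∑ k, ∑ i, P k i * (Tk k i j - ∑ l, christoffelSymbol P Gk l k i * T l j
      - ∑ l, christoffelSymbol P Gk l k j * T i l) =
      ∑ k, (P * Tk k) k j - ∑ k, (P * Gk k * P * T) k j
        + (1 / 2) * ∑ k, (P * Gk k).trace * (P * T) k j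
        - (1 / 2) * (P * T * P * Gk j).trace := fun j => by
    have e2 : ∑ k, ∑ i, P k i * ∑ l, christoffelSymbol P Gk l k i * T l j =
        ∑ k, (P * Gk k * P * T) k j - (1 / 2) * ∑ k, (P * Gk k).trace * (P * T) k j := by
      have : ∑ k, ∑ i, P k i * ∑ l, christoffelSymbol P Gk l k i * T l j =
          ∑ l, (∑ k, ∑ i, P k i * christoffelSymbol P Gk l k i) * T l j := by
        simp only [Finset.mul_sum, Finset.sum_mul]
        simp_rw [Finset.sum_comm (s := (Finset.univ : Finset (Fin n))) (t := Finset.univ)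
          (f := fun i l => P _ i * (christoffelSymbol P Gk l _ i * T l j))]
        rw [Finset.sum_comm]
        refine Finset.sum_congr rfl fun m _ => Finset.sum_congr rfl fun l _ =>
          Finset.sum_congr rfl fun i _ => by ring
      rw [this]
      simp only [sum_mul_christoffelSymbol_trace hP hG, sub_mul, Finset.sum_sub_distrib]
      congr 1
      · simp only [Finset.sum_mul]
        rw [Finset.sum_comm]
        exact Finset.sum_congr rfl fun k _ => (Matrix.mul_apply (M := P * Gk k * P)).symm
      · simp only [Matrix.mul_apply (M := P) (N := T), Finset.mul_sum, Finset.sum_mul]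
        rw [Finset.sum_comm]
        exact Finset.sum_congr rfl fun k _ => Finset.sum_congr rfl fun l _ => by ring
    simp only [mul_sub, Finset.sum_sub_distrib, e2, sum_mul_christoffelSymbol_mul hP hT hG,
      Matrix.mul_apply (M := P) (N := Tk _)]
    ring
  simp only [hj, divergenceForm, Matrix.mulVec, dotProduct, Finset.sum_add_distrib,
    Finset.sum_sub_distrib, neg_mul, Finset.sum_neg_distrib, sub_mul, add_mul]
  have s : ∀ f : Fin n → Fin n → ℝ, ∑ j, (∑ k, f k j) * v j = ∑ k, ∑ j, f k j * v j := fun f => by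
    simp only [Finset.sum_mul]; rw [Finset.sum_comm]
  have s' : ∑ j, (1 / 2) * (∑ k, (P * Gk k).trace * (P * T) k j) * v j =
      ∑ k, (1 / 2) * ((P * Gk k).trace * ∑ j, (P * T) k j * v j) := by
    simp only [Finset.mul_sum, Finset.sum_mul]; rw [Finset.sum_comm]
    exact Finset.sum_congr rfl fun k _ => Finset.sum_congr rfl fun l _ => by ring
  rw [s, s, s']
  congr 2
  exact Finset.sum_congr rfl fun k _ => by ring

end MatrixAlgebra

/-! ### The flux field and its divergence, as matrix identities. -/

section FluxField

variable {n : ℕ}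

/-- The components of the vector field `tr(SK) X + 2 KSX - tr(K) SX`, where `S` and `K` are the
endomorphisms associated with `T` and `H` by the inverse metric `P`. -/
def fluxVec (P T H : Matrix (Fin n) (Fin n) ℝ) (X : Fin n → ℝ) : Fin n → ℝ :=
  (P * T * P * H).trace • X + (2 : ℝ) • ((P * H * P * T) *ᵥ X)
    - (P * H).trace • ((P * T) *ᵥ X)

/-- The derivative of `fluxVec` along a curve, in terms of the derivatives of its arguments (the
derivative of the metric being `G'`). -/
def fluxVecDeriv (P G' T T' H H' : Matrix (Fin n) (Fin n) ℝ) (X X' : Fin n → ℝ) : Fin n → ℝ :=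
  ((P * T' * P * H).trace - (P * G' * P * T * P * H).trace + (P * T * P * H').trace
      - (P * T * P * G' * P * H).trace) • X + (P * T * P * H).trace • X'
    + (2 : ℝ) • ((P * H' * P * T - P * G' * P * H * P * T + P * H * P * T'
      - P * H * P * G' * P * T) *ᵥ X + (P * H * P * T) *ᵥ X')
    - (((P * H').trace - (P * G' * P * H).trace) • ((P * T) *ᵥ X)
      + (P * H).trace • ((P * T' - P * G' * P * T) *ᵥ X + (P * T) *ᵥ X'))

/-- The derivative of `divergenceForm` when the metric varies in the direction `H`. -/
def divergenceFormDeriv (P : Matrix (Fin n) (Fin n) ℝ) (Gk : Fin n → Matrix (Fin n) (Fin n) ℝ)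
    (H : Matrix (Fin n) (Fin n) ℝ) (Hk : Fin n → Matrix (Fin n) (Fin n) ℝ)
    (T : Matrix (Fin n) (Fin n) ℝ) (Tk : Fin n → Matrix (Fin n) (Fin n) ℝ) (v : Fin n → ℝ) : ℝ :=
  -∑ k, (((-(P * H * P * Tk k)) *ᵥ v) k
    - ((P * Hk k * P * T - P * H * P * Gk k * P * T - P * Gk k * P * H * P * T) *ᵥ v) k
    + (1 / 2) * (((P * Hk k).trace - (P * H * P * Gk k).trace) * ((P * T) *ᵥ v) k
      - (P * Gk k).trace * ((P * H * P * T) *ᵥ v) k)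
    - (1 / 2) * (v k * ((P * T * P * Hk k).trace - (P * H * P * T * P * Gk k).trace
      - (P * T * P * H * P * Gk k).trace)))

/-- This is twice the coordinate expression of the divergence of `Z`: each of the two Jacobian terms
of the Lie derivative contributes `tr J`. -/
theorem matrixInner_lieMatrix_self {G P : Matrix (Fin n) (Fin n) ℝ} (hG : G.IsSymm)
    (hP : P.IsSymm) (hPG : P * G = 1) (Gk : Fin n → Matrix (Fin n) (Fin n) ℝ) (Z : Fin n → ℝ)
    (J : Matrix (Fin n) (Fin n) ℝ) :
    matrixInner P (lieMatrix G Gk Z J) G = ∑ k, Z k * (P * Gk k).trace + 2 * J.trace := by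
  have hGP : G * P = 1 := mul_eq_one_comm.mp hPG
  have e1 : (P * (Jᵀ * G)).trace = J.trace := by
    rw [Matrix.trace_mul_comm, Matrix.mul_assoc, hGP, Matrix.mul_one, Matrix.trace_transpose]
  have e2 : (P * (G * J)).trace = J.trace := by rw [← Matrix.mul_assoc, hPG, Matrix.one_mul]
  rw [matrixInner, hP, hG, Matrix.mul_assoc _ P G, hPG, Matrix.mul_one, lieMatrix, Matrix.mul_add,
    Matrix.mul_add, Matrix.trace_add, Matrix.trace_add, e1, e2, Matrix.mul_sum, Matrix.trace_sum]
  simp only [Matrix.mul_smul, Matrix.trace_smul, smul_eq_mul]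
  ring

/-- The two Jacobian terms have the same trace, by transposition and cyclicity, since all three
bilinear forms are symmetric. -/
theorem matrixInner_lieMatrix {P T H : Matrix (Fin n) (Fin n) ℝ} (hP : P.IsSymm) (hT : T.IsSymm)
    (hH : H.IsSymm) (Tk : Fin n → Matrix (Fin n) (Fin n) ℝ) (X : Fin n → ℝ)
    (J : Matrix (Fin n) (Fin n) ℝ) :
    matrixInner P (lieMatrix T Tk X J) H =
      ∑ k, X k * (P * Tk k * P * H).trace + 2 * (P * H * P * T * J).trace := by
  have e2 : (P * (T * J) * P * H).trace = (P * H * P * T * J).trace := by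
    rw [Matrix.mul_assoc _ P H, Matrix.trace_mul_comm]
    simp only [Matrix.mul_assoc]
  have e1 : (P * (Jᵀ * T) * P * H).trace = (P * H * P * T * J).trace := by
    rw [← Matrix.trace_transpose]
    simp only [Matrix.transpose_mul, hP.eq, hT.eq, hH.eq, Matrix.transpose_transpose]
    rw [← Matrix.mul_assoc, ← Matrix.mul_assoc, ← Matrix.mul_assoc, Matrix.trace_mul_comm]
    simp only [Matrix.mul_assoc]
  rw [matrixInner, hP, hH, lieMatrix]
  simp only [Matrix.mul_add, Matrix.add_mul, Matrix.trace_add, e1, e2, Matrix.mul_sum,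
    Matrix.sum_mul, Matrix.trace_sum, Matrix.mul_smul, Matrix.smul_mul, Matrix.trace_smul,
    smul_eq_mul]
  ring

/-- The divergence of the flux field. -/
theorem matrixInner_lieMatrix_fluxVec {G P T H J : Matrix (Fin n) (Fin n) ℝ}
    {Gk Tk Hk : Fin n → Matrix (Fin n) (Fin n) ℝ} {X : Fin n → ℝ} (hG : G.IsSymm)
    (hP : P.IsSymm) (hT : T.IsSymm) (hH : H.IsSymm) (hPG : P * G = 1)
    (hdiv : divergenceForm P Gk T Tk X = 0) (hlie : lieMatrix G Gk X J = 0) :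
    matrixInner P (lieMatrix G Gk (fluxVec P T H X)
        (Matrix.of fun a k => fluxVecDeriv P (Gk k) T (Tk k) H (Hk k) X (fun i => J i k) a)) G =
      2 * (matrixInner P (lieMatrix T Tk X J) H + 2 * divergenceFormDeriv P Gk H Hk T Tk X) := by
  have hGP : G * P = 1 := mul_eq_one_comm.mp hPG
  -- The Killing equation enters only through its pairings with a matrix `R`: `R = P` says `div X =
  -- 0`, and `R = P T P` says `⟨τ, L_X γ⟩ = 0`.
  have hL : ∀ R : Matrix (Fin n) (Fin n) ℝ,
      ∑ k, X k * (R * Gk k).trace = -((R * Jᵀ * G).trace + (R * G * J).trace) := fun R => by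
    have := congrArg (fun A => (R * A).trace) hlie
    simp only [lieMatrix, Matrix.mul_add, Matrix.trace_add, Matrix.mul_sum, Matrix.trace_sum,
      Matrix.mul_smul, Matrix.trace_smul, smul_eq_mul, Matrix.mul_zero, Matrix.trace_zero,
      ← Matrix.mul_assoc] at this
    linarith
  have hL1 : ∑ k, X k * (P * Gk k).trace = -(2 * J.trace) := by
    rw [hL, Matrix.mul_assoc, Matrix.trace_mul_comm, Matrix.mul_assoc, hGP, Matrix.mul_one,
      Matrix.trace_transpose, hPG, Matrix.one_mul]
    ring
  have hL2 : ∑ k, X k * (P * T * P * Gk k).trace = -(2 * (P * T * J).trace) := by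
    have e1 : (P * T * P * Jᵀ * G).trace = (P * T * J).trace := by
      rw [Matrix.trace_mul_comm]
      simp only [← Matrix.mul_assoc]
      rw [hGP, Matrix.one_mul, ← Matrix.trace_transpose]
      simp only [Matrix.transpose_mul, hP.eq, hT.eq, Matrix.transpose_transpose]
      rw [Matrix.trace_mul_comm]
    rw [hL, e1, Matrix.mul_assoc _ P G, hPG, Matrix.mul_one]
    ring
  rw [matrixInner_lieMatrix_self hG hP hPG, matrixInner_lieMatrix hP hT hH]
  -- An identity for each `k`, using only cyclicity of traces. Its last three groups, once summed
  -- over `k`, are multiples of `(δτ)(X)`, `div X` and `⟨τ, L_X γ⟩`, which vanish by `hdiv`, `hL1`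
  -- and `hL2`.
  have hk : ∀ k, fluxVec P T H X k * (P * Gk k).trace
      + 2 * fluxVecDeriv P (Gk k) T (Tk k) H (Hk k) X (fun i => J i k) k =
      2 * (X k * (P * Tk k * P * H).trace) + 4 * (P * H * P * T * J) k k
      - 4 * (((-(P * H * P * Tk k)) *ᵥ X) k
    - ((P * Hk k * P * T - P * H * P * Gk k * P * T - P * Gk k * P * H * P * T) *ᵥ X) k
    + (1 / 2) * (((P * Hk k).trace - (P * H * P * Gk k).trace) * ((P * T) *ᵥ X) k
      - (P * Gk k).trace * ((P * H * P * T) *ᵥ X) k)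
    - (1 / 2) * (X k * ((P * T * P * Hk k).trace - (P * H * P * T * P * Gk k).trace
      - (P * T * P * H * P * Gk k).trace)))
      - 2 * (P * H).trace * (((P * Tk k) *ᵥ X) k - ((P * Gk k * P * T) *ᵥ X) k
    + (1 / 2) * ((P * Gk k).trace * ((P * T) *ᵥ X) k) - (1 / 2) * (X k * (P * T * P * Gk k).trace))
      + (P * T * P * H).trace * (X k * (P * Gk k).trace + 2 * J k k)
      - (P * H).trace * (X k * (P * T * P * Gk k).trace + 2 * (P * T * J) k k) := fun k => by
    have m : ∀ A : Matrix (Fin n) (Fin n) ℝ, (A *ᵥ fun i => J i k) k = (A * J) k k := fun A => rfl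
    have c1 : (P * Gk k * P * T * P * H).trace = (P * T * P * H * P * Gk k).trace := by
      simp only [Matrix.mul_assoc]; rw [← Matrix.mul_assoc, Matrix.trace_mul_comm]
      simp only [Matrix.mul_assoc]
    have c2 : (P * T * P * Gk k * P * H).trace = (P * H * P * T * P * Gk k).trace := by
      rw [Matrix.mul_assoc _ P H, Matrix.trace_mul_comm]
      simp only [Matrix.mul_assoc]
    have c3 : (P * Gk k * P * H).trace = (P * H * P * Gk k).trace := by
      rw [Matrix.mul_assoc _ P H, Matrix.trace_mul_comm]
      simp only [Matrix.mul_assoc]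
    simp only [fluxVec, fluxVecDeriv, Pi.add_apply, Pi.sub_apply, Pi.smul_apply, smul_eq_mul,
      Matrix.sub_mulVec, Matrix.add_mulVec, Matrix.neg_mulVec, Pi.neg_apply, m, c1, c2, c3]
    ring
  have hsum : ∑ k, fluxVec P T H X k * (P * Gk k).trace + 2 * (Matrix.of fun a k =>
      fluxVecDeriv P (Gk k) T (Tk k) H (Hk k) X (fun i => J i k) a).trace =
      ∑ k, (fluxVec P T H X k * (P * Gk k).trace
      + 2 * fluxVecDeriv P (Gk k) T (Tk k) H (Hk k) X (fun i => J i k) k) := by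
    rw [Finset.sum_add_distrib, Matrix.trace, ← Finset.mul_sum]
    rfl
  have t1 : ∑ k, (P * H * P * T * J) k k = (P * H * P * T * J).trace := rfl
  have t2 : ∑ k, (P * T * J) k k = (P * T * J).trace := rfl
  have t3 : ∑ k, J k k = J.trace := rfl
  rw [divergenceForm, neg_eq_zero] at hdiv
  rw [hsum, Finset.sum_congr rfl fun k _ => hk k, Finset.sum_sub_distrib, Finset.sum_add_distrib,
    Finset.sum_sub_distrib, Finset.sum_sub_distrib, Finset.sum_add_distrib, ← Finset.mul_sum,
    ← Finset.mul_sum, ← Finset.mul_sum, ← Finset.mul_sum, ← Finset.mul_sum, ← Finset.mul_sum, hdiv,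
    divergenceFormDeriv, Finset.sum_add_distrib, Finset.sum_add_distrib, ← Finset.mul_sum,
    ← Finset.mul_sum, hL1, hL2, t1, t2, t3]
  ring

end FluxField

/-! ### Derivatives of matrix expressions along a curve. -/

section MatrixCalculus

variable {n : ℕ}

-- The operator norm makes square matrices a normed algebra, so that the product rule and the
-- derivative of `Ring.inverse` apply.
open scoped Matrix.Norms.Operator

theorem hasDerivAt_matrix_inv {G : ℝ → Matrix (Fin n) (Fin n) ℝ} {G' : Matrix (Fin n) (Fin n) ℝ}
    {t : ℝ} (hG : HasDerivAt G G' t) (hu : IsUnit (G t).det) :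
    HasDerivAt (fun s => (G s)⁻¹) (-((G t)⁻¹ * G' * (G t)⁻¹)) t := by
  obtain ⟨u, hu'⟩ := (Matrix.isUnit_iff_isUnit_det _).mpr hu
  have h1 := hasFDerivAt_ringInverse (𝕜 := ℝ) u
  rw [hu'] at h1
  have h2 := h1.comp_hasDerivAt t hG
  have h3 : ((u⁻¹ : (Matrix (Fin n) (Fin n) ℝ)ˣ) : Matrix (Fin n) (Fin n) ℝ) = (G t)⁻¹ := by
    rw [← hu', Matrix.nonsing_inv_eq_ringInverse, Ring.inverse_unit]
  simp only [h3, _root_.neg_apply, ContinuousLinearMap.mulLeftRight_apply] at h2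
  refine h2.congr_of_eventuallyEq (Eventually.of_forall fun s => ?_)
  exact Matrix.nonsing_inv_eq_ringInverse _

theorem hasDerivAt_matrix_trace {A : ℝ → Matrix (Fin n) (Fin n) ℝ} {A' : Matrix (Fin n) (Fin n) ℝ}
    {t : ℝ} (hA : HasDerivAt A A' t) : HasDerivAt (fun s => (A s).trace) A'.trace t :=
  (Matrix.traceLinearMap (Fin n) ℝ ℝ).toContinuousLinearMap.hasFDerivAt.comp_hasDerivAt t hA

theorem hasDerivAt_mulVec {A : ℝ → Matrix (Fin n) (Fin n) ℝ} {A' : Matrix (Fin n) (Fin n) ℝ}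
    {v : ℝ → Fin n → ℝ} {v' : Fin n → ℝ} {t : ℝ} (hA : HasDerivAt A A' t)
    (hv : HasDerivAt v v' t) :
    HasDerivAt (fun s => A s *ᵥ v s) (A' *ᵥ v t + A t *ᵥ v') t := by
  have hAe : ∀ i j, HasDerivAt (fun s => A s i j) (A' i j) t := fun i j =>
    (Matrix.entryLinearMap ℝ ℝ i j).toContinuousLinearMap.hasFDerivAt.comp_hasDerivAt t hA
  rw [hasDerivAt_pi] at hv ⊢
  intro i
  have := HasDerivAt.fun_sum (u := Finset.univ) fun j _ => (hAe i j).mul (hv j)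
  rw [Finset.sum_add_distrib] at this
  exact this

theorem hasDerivAt_fluxVec {G T H : ℝ → Matrix (Fin n) (Fin n) ℝ} {X : ℝ → Fin n → ℝ}
    {G' T' H' : Matrix (Fin n) (Fin n) ℝ} {X' : Fin n → ℝ} {t : ℝ} (hG : HasDerivAt G G' t)
    (hu : IsUnit (G t).det) (hT : HasDerivAt T T' t) (hH : HasDerivAt H H' t)
    (hX : HasDerivAt X X' t) :
    HasDerivAt (fun s => fluxVec (G s)⁻¹ (T s) (H s) (X s))
      (fluxVecDeriv (G t)⁻¹ G' (T t) T' (H t) H' (X t) X') t := by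
  have hP := hasDerivAt_matrix_inv hG hu
  have hS := hP.fun_mul hT
  have hK := hP.fun_mul hH
  have hSK := (hS.fun_mul hP).fun_mul hH
  have hKS := (hK.fun_mul hP).fun_mul hT
  have := (((hasDerivAt_matrix_trace hSK).fun_smul hX).fun_add
    ((hasDerivAt_mulVec hKS hX).fun_const_smul (2 : ℝ))).fun_sub
    ((hasDerivAt_matrix_trace hK).fun_smul (hasDerivAt_mulVec hS hX))
  refine this.congr_deriv ?_
  simp only [fluxVecDeriv, Matrix.trace_add, Matrix.add_mulVec, Matrix.sub_mulVec, Matrix.add_mul,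
    Matrix.mul_neg, Matrix.neg_mul, Matrix.trace_neg, Matrix.neg_mulVec,
    ← Matrix.mul_assoc]
  module

/-- Both the metric and its partial derivatives move along the line; `T`, `Tk` and `v` stay fixed.
Invertibility is needed at `s = 0` only. -/
theorem hasDerivAt_divergenceForm {G H T : Matrix (Fin n) (Fin n) ℝ}
    {Gk Hk Tk : Fin n → Matrix (Fin n) (Fin n) ℝ} (hu : IsUnit G.det) (v : Fin n → ℝ) :
    HasDerivAt (fun s : ℝ => divergenceForm (G + s • H)⁻¹ (fun k => Gk k + s • Hk k) T Tk v)
      (divergenceFormDeriv G⁻¹ Gk H Hk T Tk v) 0 := by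
  have line : ∀ A B : Matrix (Fin n) (Fin n) ℝ, HasDerivAt (fun s : ℝ => A + s • B) B 0 :=
    fun A B => (((hasDerivAt_id (0 : ℝ)).smul_const B).const_add A).congr_deriv (one_smul _ _)
  have hP := hasDerivAt_matrix_inv (line G H) (by simpa using hu)
  simp only [zero_smul, add_zero] at hP
  have hv := hasDerivAt_const (0 : ℝ) v
  have hM : ∀ A : Matrix (Fin n) (Fin n) ℝ, HasDerivAt (fun _ : ℝ => A) 0 0 :=
    fun A => hasDerivAt_const _ A
  have hS := hP.fun_mul (hM T)
  have hk := fun k => (((hasDerivAt_pi.mp (hasDerivAt_mulVec (hP.fun_mul (hM (Tk k))) hv) k).fun_sub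
    (hasDerivAt_pi.mp (hasDerivAt_mulVec
      (((hP.fun_mul (line (Gk k) (Hk k))).fun_mul hP).fun_mul (hM T)) hv) k)).fun_add
    (((hasDerivAt_matrix_trace (hP.fun_mul (line (Gk k) (Hk k)))).fun_mul
      (hasDerivAt_pi.mp (hasDerivAt_mulVec hS hv) k)).const_mul (1 / 2 : ℝ))).fun_sub
    (((hasDerivAt_matrix_trace ((hS.fun_mul hP).fun_mul (line (Gk k) (Hk k)))).const_mul
      (v k)).const_mul (1 / 2 : ℝ))
  refine (HasDerivAt.fun_sum (u := Finset.univ) fun k _ => hk k).fun_neg.congr_deriv ?_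
  rw [divergenceFormDeriv]
  congr 1
  refine Finset.sum_congr rfl fun k _ => ?_
  simp only [zero_smul, add_zero, Matrix.trace_add, Matrix.add_mulVec, Matrix.sub_mulVec,
    Matrix.add_mul, Matrix.mulVec_zero, Matrix.mul_zero, Pi.add_apply, Pi.sub_apply, Pi.neg_apply,
    Pi.zero_apply, Matrix.mul_neg, Matrix.neg_mul, Matrix.trace_neg, Matrix.neg_mulVec,
    ← Matrix.mul_assoc]
  ring

end MatrixCalculus

/-! ### Change of coordinates, Jacobi's formula and the divergence in `ℝⁿ`. -/

section VectorCalculus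

variable {n : ℕ}

open scoped Matrix.Norms.Operator

/-- The standard basis vector. -/
abbrev stdVec (i : Fin n) : Model n := EuclideanSpace.single i (1 : ℝ)

theorem sum_smul_stdVec (v : Fin n → ℝ) : ∑ i, v i • stdVec i = WithLp.toLp 2 v := by
  ext j
  simp [stdVec, Finset.sum_apply, Pi.single_apply]

theorem map_toLp_eq_sum {F : Type*} [AddCommGroup F] [Module ℝ F] [TopologicalSpace F]
    (L : Model n →L[ℝ] F) (v : Fin n → ℝ) : L (WithLp.toLp 2 v) = ∑ i, v i • L (stdVec i) := by
  rw [← sum_smul_stdVec, map_sum]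
  simp only [map_smul]

/-- The matrix of an endomorphism of the model space. -/
def linMatrix (L : Model n →L[ℝ] Model n) : Matrix (Fin n) (Fin n) ℝ :=
  Matrix.of fun a i => L (stdVec i) a

theorem linMatrix_mulVec (L : Model n →L[ℝ] Model n) (v : Fin n → ℝ) :
    WithLp.toLp 2 (linMatrix L *ᵥ v) = L (WithLp.toLp 2 v) := by
  rw [map_toLp_eq_sum]
  ext a
  simp [linMatrix, Matrix.mulVec, dotProduct, mul_comm]

theorem linMatrix_eq_toMatrix (L : Model n →L[ℝ] Model n) :
    linMatrix L = LinearMap.toMatrix (EuclideanSpace.basisFun (Fin n) ℝ).toBasis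
      (EuclideanSpace.basisFun (Fin n) ℝ).toBasis (L : Model n →ₗ[ℝ] Model n) := by
  ext a i
  simp [linMatrix, LinearMap.toMatrix_apply]

theorem linMatrix_comp (L L' : Model n →L[ℝ] Model n) :
    linMatrix (L.comp L') = linMatrix L * linMatrix L' := by
  simp only [linMatrix_eq_toMatrix, ← LinearMap.toMatrix_comp]
  rfl

theorem linMatrix_id : linMatrix (ContinuousLinearMap.id ℝ (Model n)) = 1 := by
  simp only [linMatrix_eq_toMatrix, ContinuousLinearMap.coe_id, LinearMap.toMatrix_id]

theorem det_linMatrix (L : Model n →L[ℝ] Model n) : (linMatrix L).det = L.det := by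
  rw [linMatrix_eq_toMatrix, LinearMap.det_toMatrix]

/-- `linMatrix` as a continuous linear map. -/
def linMatrixCLM (n : ℕ) : (Model n →L[ℝ] Model n) →L[ℝ] Matrix (Fin n) (Fin n) ℝ :=
  LinearMap.toContinuousLinearMap
    { toFun := linMatrix
      map_add' := fun L L' => by ext; simp [linMatrix]
      map_smul' := fun c L => by ext; simp [linMatrix] }

/-- The Jacobian matrix of a vector-valued function. -/
def jacobian (X : Model n → Fin n → ℝ) (p : Model n) : Matrix (Fin n) (Fin n) ℝ :=
  Matrix.of fun a i => fderiv ℝ X p (stdVec i) a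

/-- The Lie derivative is covariant under changes of coordinates. -/
theorem lieMatrix_congruence {T T' : Model n → Matrix (Fin n) (Fin n) ℝ}
    {X X' : Model n → Fin n → ℝ} {Φ : Model n → Model n} {p : Model n}
    (hΦ : ContDiffAt ℝ 2 Φ p) (hT' : DifferentiableAt ℝ T' (Φ p))
    (hX : DifferentiableAt ℝ X p) (hX' : DifferentiableAt ℝ X' (Φ p))
    (hTT' : T =ᶠ[𝓝 p] fun q =>
      (linMatrix (fderiv ℝ Φ q))ᵀ * T' (Φ q) * linMatrix (fderiv ℝ Φ q))
    (hXX' : (fun q => X' (Φ q)) =ᶠ[𝓝 p] fun q => linMatrix (fderiv ℝ Φ q) *ᵥ X q) :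
    lieMatrix (T p) (fun k => fderiv ℝ T p (stdVec k)) (X p) (jacobian X p) =
      (linMatrix (fderiv ℝ Φ p))ᵀ *
        lieMatrix (T' (Φ p)) (fun k => fderiv ℝ T' (Φ p) (stdVec k)) (X' (Φ p))
          (jacobian X' (Φ p)) * linMatrix (fderiv ℝ Φ p) := by
  have hΦ1 : DifferentiableAt ℝ Φ p := hΦ.differentiableAt (by norm_num)
  have hΦ2 : DifferentiableAt ℝ (fderiv ℝ Φ) p :=
    (hΦ.fderiv_right (m := 1) (by norm_num)).differentiableAt (by norm_num)
  have hsymm : IsSymmSndFDerivAt ℝ Φ p := hΦ.isSymmSndFDerivAt (by simp)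
  set A : Model n → Matrix (Fin n) (Fin n) ℝ := fun q => linMatrix (fderiv ℝ Φ q) with hA
  have hdA : HasFDerivAt A ((linMatrixCLM n).comp (fderiv ℝ (fderiv ℝ Φ) p)) p :=
    (linMatrixCLM n).hasFDerivAt.comp p hΦ2.hasFDerivAt
  set A' := (linMatrixCLM n).comp (fderiv ℝ (fderiv ℝ Φ) p)
  -- Symmetry of the second derivative of `Φ`: this is what makes the Lie derivative tensorial.
  have hA'symm : ∀ v w : Fin n → ℝ, A' (WithLp.toLp 2 v) *ᵥ w = A' (WithLp.toLp 2 w) *ᵥ v :=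
    fun v w => by
      have : WithLp.toLp 2 (A' (WithLp.toLp 2 v) *ᵥ w) =
          WithLp.toLp 2 (A' (WithLp.toLp 2 w) *ᵥ v) := by
        change WithLp.toLp 2 (linMatrix _ *ᵥ w) = WithLp.toLp 2 (linMatrix _ *ᵥ v)
        rw [linMatrix_mulVec, linMatrix_mulVec]
        exact hsymm _ _
      exact WithLp.toLp_injective 2 this
  have hXp : X' (Φ p) = A p *ᵥ X p := hXX'.self_of_nhds
  have hTp : T p = (A p)ᵀ * T' (Φ p) * A p := hTT'.self_of_nhds
  have hdT : ∀ w, fderiv ℝ T p w = (A' w)ᵀ * T' (Φ p) * A p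
      + (A p)ᵀ * fderiv ℝ T' (Φ p) (fderiv ℝ Φ p w) * A p + (A p)ᵀ * T' (Φ p) * A' w := fun w => by
    have h1 := hdA.hasLineDerivAt w
    have hAt := (Matrix.transposeLinearEquiv (Fin n) (Fin n) ℝ
      ℝ).toLinearMap.toContinuousLinearMap.hasFDerivAt.comp p hdA
    have h1t := hAt.hasLineDerivAt w
    have h2 := (hT'.hasFDerivAt.comp p hΦ1.hasFDerivAt).hasLineDerivAt w
    have h3 := (h1t.fun_mul h2).fun_mul h1
    have h4 : HasFDerivAt T (fderiv ℝ T p) p := by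
      refine DifferentiableAt.hasFDerivAt (DifferentiableAt.congr_of_eventuallyEq ?_ hTT')
      exact (((Matrix.transposeLinearEquiv (Fin n) (Fin n) ℝ ℝ).toLinearMap.toContinuousLinearMap.hasFDerivAt.comp
        p hdA).differentiableAt.mul (hT'.comp p hΦ1)).mul hdA.differentiableAt
    have h5 := (h4.congr_of_eventuallyEq hTT'.symm).hasLineDerivAt w
    have h6 := h5.unique h3
    refine h6.trans ?_
    simp only [zero_smul, add_zero, Matrix.add_mul]
    rfl
  -- Differentiate `X' ∘ Φ = A X`. The symmetry `hA'symm` turns the columns `A'(eᵢ) X` into the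
  -- matrix `A'(X)`, the same second-order term that `hdT` produces in the direction `X`.
  have hJ : jacobian X' (Φ p) * A p = A p * jacobian X p + A' (WithLp.toLp 2 (X p)) := by
    have h1 : ∀ w, fderiv ℝ X' (Φ p) (fderiv ℝ Φ p w) = A' w *ᵥ X p + A p *ᵥ fderiv ℝ X p w :=
      fun w => by
        have h2 := (hX'.hasFDerivAt.comp p hΦ1.hasFDerivAt).congr_of_eventuallyEq hXX'.symm
        have h3 := hasDerivAt_mulVec (hdA.hasLineDerivAt w) (hX.hasFDerivAt.hasLineDerivAt w)
        have h4 := (h2.hasLineDerivAt w).unique h3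
        refine h4.trans ?_
        simp only [zero_smul, add_zero]
        rfl
    ext a i
    have h2 := congrFun (h1 (stdVec i)) a
    have h3 : fderiv ℝ X' (Φ p) (fderiv ℝ Φ p (stdVec i)) a = (jacobian X' (Φ p) * A p) a i := by
      have : fderiv ℝ Φ p (stdVec i) = WithLp.toLp 2 (fun j => A p j i) := rfl
      rw [this, map_toLp_eq_sum]
      simp [Matrix.mul_apply, jacobian, mul_comm]
    have h4 : (A' (stdVec i) *ᵥ X p) a = A' (WithLp.toLp 2 (X p)) a i := by
      have := congrFun (hA'symm (Pi.single i 1) (X p)) a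
      have h5 : (WithLp.toLp 2 (Pi.single i 1) : Model n) = stdVec i := rfl
      rw [h5] at this
      rw [this]
      simp
    rw [← h3, h2, Pi.add_apply, h4, Matrix.add_apply, add_comm]
    rfl
  have hJt := congrArg Matrix.transpose hJ
  simp only [Matrix.transpose_mul, Matrix.transpose_add] at hJt
  have hdX : fderiv ℝ Φ p (WithLp.toLp 2 (X p)) = WithLp.toLp 2 (X' (Φ p)) := by
    rw [hXp, linMatrix_mulVec]
  have e1 : (A p)ᵀ * ((jacobian X' (Φ p))ᵀ * T' (Φ p)) * A p =
      ((jacobian X p)ᵀ * (A p)ᵀ + (A' (WithLp.toLp 2 (X p)))ᵀ) * T' (Φ p) * A p := by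
    rw [← hJt]; simp only [Matrix.mul_assoc]
  have e2 : (A p)ᵀ * (T' (Φ p) * jacobian X' (Φ p)) * A p =
      (A p)ᵀ * T' (Φ p) * (A p * jacobian X p + A' (WithLp.toLp 2 (X p))) := by
    rw [← hJ]; simp only [Matrix.mul_assoc]
  rw [lieMatrix, lieMatrix, ← map_toLp_eq_sum (fderiv ℝ T p),
    ← map_toLp_eq_sum (fderiv ℝ T' (Φ p)), hdT, hdX, hTp, Matrix.mul_add,
    Matrix.mul_add, Matrix.add_mul, Matrix.add_mul, e1, e2]
  simp only [Matrix.mul_add, Matrix.add_mul, Matrix.mul_assoc]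
  abel

/-- The factors `A` and `A⁻¹` cancel between neighbours, and at the two ends by cyclicity of the
trace. -/
theorem matrixInner_congruence {P A L H : Matrix (Fin n) (Fin n) ℝ} (hA : IsUnit A.det) :
    matrixInner (A⁻¹ * P * (A⁻¹)ᵀ) (Aᵀ * L * A) (Aᵀ * H * A) = matrixInner P L H := by
  have h1 : A * A⁻¹ = 1 := Matrix.mul_nonsing_inv _ hA
  have h2 : (A⁻¹)ᵀ * Aᵀ = 1 := by rw [← Matrix.transpose_mul, h1, Matrix.transpose_one]
  have : ((A⁻¹ * P * (A⁻¹)ᵀ)ᵀ * (Aᵀ * L * A) * (A⁻¹ * P * (A⁻¹)ᵀ) * (Aᵀ * H * A)ᵀ) =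
      A⁻¹ * (Pᵀ * L * P * Hᵀ * A) := by
    simp only [Matrix.transpose_mul, Matrix.transpose_transpose]
    calc _ = A⁻¹ * Pᵀ * ((A⁻¹)ᵀ * Aᵀ) * L * (A * A⁻¹) * P * ((A⁻¹)ᵀ * Aᵀ) * Hᵀ * A := by
          simp only [Matrix.mul_assoc]
      _ = _ := by rw [h1, h2]; simp only [Matrix.mul_one, Matrix.mul_assoc]
  rw [matrixInner, this, Matrix.trace_mul_comm, Matrix.mul_assoc _ A, h1, Matrix.mul_one,
    matrixInner]

theorem inv_congruence {G A : Matrix (Fin n) (Fin n) ℝ} :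
    (Aᵀ * G * A)⁻¹ = A⁻¹ * G⁻¹ * (A⁻¹)ᵀ := by
  rw [Matrix.mul_inv_rev, Matrix.mul_inv_rev, Matrix.transpose_nonsing_inv, Matrix.mul_assoc]

/-- Products such as `P T` and `P H` are endomorphisms, hence conjugated by `A`: traces are
unchanged and vectors are mapped by `A`. -/
theorem fluxVec_congruence {P A T H : Matrix (Fin n) (Fin n) ℝ} {X : Fin n → ℝ}
    (hA : IsUnit A.det) :
    A *ᵥ fluxVec (A⁻¹ * P * (A⁻¹)ᵀ) (Aᵀ * T * A) (Aᵀ * H * A) X = fluxVec P T H (A *ᵥ X) := by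
  have h1 : A * A⁻¹ = 1 := Matrix.mul_nonsing_inv _ hA
  have h2 : (A⁻¹)ᵀ * Aᵀ = 1 := by rw [← Matrix.transpose_mul, h1, Matrix.transpose_one]
  have e1 : ∀ B : Matrix (Fin n) (Fin n) ℝ,
      A⁻¹ * P * (A⁻¹)ᵀ * (Aᵀ * B * A) = A⁻¹ * (P * B * A) := fun B => by
    calc _ = A⁻¹ * P * ((A⁻¹)ᵀ * Aᵀ) * B * A := by simp only [Matrix.mul_assoc]
      _ = _ := by rw [h2]; simp only [Matrix.mul_one, Matrix.mul_assoc]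
  have e2 : ∀ B C : Matrix (Fin n) (Fin n) ℝ,
      A⁻¹ * P * (A⁻¹)ᵀ * (Aᵀ * B * A) * (A⁻¹ * P * (A⁻¹)ᵀ) * (Aᵀ * C * A) =
        A⁻¹ * (P * B * P * C * A) := fun B C => by
    rw [Matrix.mul_assoc _ _ (Aᵀ * C * A), e1, e1]
    calc _ = A⁻¹ * (P * B * (A * A⁻¹) * P * C * A) := by simp only [Matrix.mul_assoc]
      _ = _ := by rw [h1, Matrix.mul_one]
  have e3 : ∀ B : Matrix (Fin n) (Fin n) ℝ, (A⁻¹ * (B * A)).trace = B.trace := fun B => by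
    rw [Matrix.trace_mul_comm, Matrix.mul_assoc, h1, Matrix.mul_one]
  have e4 : ∀ B : Matrix (Fin n) (Fin n) ℝ, A *ᵥ ((A⁻¹ * (B * A)) *ᵥ X) = B *ᵥ (A *ᵥ X) :=
    fun B => by rw [Matrix.mulVec_mulVec, ← Matrix.mul_assoc, h1, Matrix.one_mul,
      Matrix.mulVec_mulVec]
  simp only [fluxVec, e2]
  simp only [e1, e3, Matrix.mulVec_sub, Matrix.mulVec_add, Matrix.mulVec_smul, e4]

theorem differentiable_det : Differentiable ℝ fun A : Matrix (Fin n) (Fin n) ℝ => A.det := by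
  have he : ∀ i j, Differentiable ℝ fun A : Matrix (Fin n) (Fin n) ℝ => A i j := fun i j =>
    (Matrix.entryLinearMap ℝ ℝ i j).toContinuousLinearMap.differentiable
  simp only [Matrix.det_apply]
  fun_prop

theorem contDiff_det : ContDiff ℝ 1 fun A : Matrix (Fin n) (Fin n) ℝ => A.det := by
  have he : ∀ i j, ContDiff ℝ 1 fun A : Matrix (Fin n) (Fin n) ℝ => A i j := fun i j =>
    (Matrix.entryLinearMap ℝ ℝ i j).toContinuousLinearMap.contDiff
  simp only [Matrix.det_apply]
  exact ContDiff.sum fun σ _ => (contDiff_prod fun i _ => he _ _).const_smul _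

/-- Jacobi's formula. -/
theorem hasDerivAt_det {G : ℝ → Matrix (Fin n) (Fin n) ℝ} {G' : Matrix (Fin n) (Fin n) ℝ} {t : ℝ}
    (hG : HasDerivAt G G' t) (hu : IsUnit (G t).det) :
    HasDerivAt (fun s => (G s).det) ((G t).det * ((G t)⁻¹ * G').trace) t := by
  have h1 := (differentiable_det (G t)).hasFDerivAt
  have h2 := h1.comp_hasDerivAt t hG
  refine h2.congr_deriv ?_
  -- The determinant is already known to be differentiable, so its derivative at `G t` can be
  -- computed along the straight line in direction `G'`. There `det (1 + s B) = 1 + s tr B + O(s²)`.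
  have h3 := h1.hasLineDerivAt G'
  refine h3.unique ?_
  have h4 : ∀ s : ℝ, (G t + s • G').det = (G t).det * (1 + s • ((G t)⁻¹ * G')).det := fun s => by
    rw [← Matrix.det_mul, Matrix.mul_add, Matrix.mul_one, Matrix.mul_smul, ← Matrix.mul_assoc,
      Matrix.mul_nonsing_inv _ hu, Matrix.one_mul]
  rw [HasLineDerivAt]
  simp only [fun s => (h4 s).trans (congrArg _ (Matrix.det_one_add_smul s _))]
  refine HasDerivAt.const_mul _ ?_
  have h5 := (((hasDerivAt_id (0 : ℝ)).const_mul ((G t)⁻¹ * G').trace).const_add 1).add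
    (((Matrix.det (1 + (Polynomial.X : Polynomial ℝ) •
      ((G t)⁻¹ * G').map Polynomial.C)).divX.divX.hasDerivAt 0).mul ((hasDerivAt_id (0 : ℝ)).pow 2))
  exact h5.congr_deriv (by simp)

theorem contDiffAt_matrix_inv {E : Type*} [NormedAddCommGroup E] [NormedSpace ℝ E]
    {G : E → Matrix (Fin n) (Fin n) ℝ} {p : E} {m : ℕ∞ω}
    (hG : ContDiffAt ℝ m G p) (hu : IsUnit (G p).det) : ContDiffAt ℝ m (fun q => (G q)⁻¹) p := by
  obtain ⟨u, hu'⟩ := (Matrix.isUnit_iff_isUnit_det _).mpr hu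
  have h1 : ContDiffAt ℝ m Ring.inverse (G p) := hu' ▸ contDiffAt_ringInverse ℝ u
  have h2 := h1.comp p hG
  refine h2.congr_of_eventuallyEq (Eventually.of_forall fun q => ?_)
  exact Matrix.nonsing_inv_eq_ringInverse _

theorem ContDiffAt.matrix_trace {E : Type*} [NormedAddCommGroup E] [NormedSpace ℝ E]
    {A : E → Matrix (Fin n) (Fin n) ℝ} {p : E} {m : ℕ∞ω} (hA : ContDiffAt ℝ m A p) :
    ContDiffAt ℝ m (fun q => (A q).trace) p :=
  (Matrix.traceLinearMap (Fin n) ℝ ℝ).toContinuousLinearMap.contDiff.contDiffAt.comp p hA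

theorem contDiffAt_mulVec {E : Type*} [NormedAddCommGroup E] [NormedSpace ℝ E]
    {A : E → Matrix (Fin n) (Fin n) ℝ} {v : E → Fin n → ℝ} {p : E} {m : ℕ∞ω}
    (hA : ContDiffAt ℝ m A p) (hv : ContDiffAt ℝ m v p) :
    ContDiffAt ℝ m (fun q => A q *ᵥ v q) p := by
  have hAe : ∀ i j, ContDiffAt ℝ m (fun q => A q i j) p := fun i j =>
    (Matrix.entryLinearMap ℝ ℝ i j).toContinuousLinearMap.contDiff.contDiffAt.comp p hA
  rw [contDiffAt_pi] at hv ⊢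
  intro i
  change ContDiffAt ℝ m (fun q => ∑ j, A q i j * v q j) p
  exact ContDiffAt.sum fun j _ => (hAe i j).mul (hv j)

theorem contDiffAt_fluxVec {E : Type*} [NormedAddCommGroup E] [NormedSpace ℝ E]
    {G T H : E → Matrix (Fin n) (Fin n) ℝ} {X : E → Fin n → ℝ} {p : E} {m : ℕ∞ω}
    (hG : ContDiffAt ℝ m G p) (hu : IsUnit (G p).det) (hT : ContDiffAt ℝ m T p)
    (hH : ContDiffAt ℝ m H p) (hX : ContDiffAt ℝ m X p) :
    ContDiffAt ℝ m (fun q => fluxVec (G q)⁻¹ (T q) (H q) (X q)) p := by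
  have hP := contDiffAt_matrix_inv hG hu
  have hS := hP.mul hT
  have hK := hP.mul hH
  exact (((ContDiffAt.matrix_trace ((hS.mul hP).mul hH)).smul hX).add
    ((contDiffAt_mulVec ((hK.mul hP).mul hT) hX).const_smul (2 : ℝ))).sub
    ((ContDiffAt.matrix_trace hK).smul (contDiffAt_mulVec hS hX))

/-- The integral of the divergence of a compactly supported vector field of class `C¹` vanishes. -/
theorem integral_sum_fderiv_eq_zero {W : Model n → Fin n → ℝ} (hW : ContDiff ℝ 1 W)
    (hc : HasCompactSupport W) :
    ∫ p, ∑ k, fderiv ℝ (fun q => W q k) p (stdVec k) = 0 := by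
  have hWk : ∀ k, ContDiff ℝ 1 fun q => W q k := fun k => contDiff_pi.mp hW k
  have hck : ∀ k, HasCompactSupport fun q => W q k := fun k =>
    hc.comp_left (g := fun v : Fin n → ℝ => v k) rfl
  have hi : ∀ k, Integrable fun p => fderiv ℝ (fun q => W q k) p (stdVec k) := fun k => by
    refine Continuous.integrable_of_hasCompactSupport ?_ ?_
    · exact ((hWk k).continuous_fderiv (by norm_num)).clm_apply continuous_const
    · exact (hck k).fderiv_apply (𝕜 := ℝ) _
  rw [integral_finsetSum _ fun k _ => hi k]
  refine Finset.sum_eq_zero fun k _ => ?_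
  -- Integration by parts against the constant function `1`.
  have := integral_mul_fderiv_eq_neg_fderiv_mul_of_integrable (μ := (volume : Measure (Model n)))
    (f := fun _ => (1 : ℝ)) (g := fun q => W q k) (v := stdVec k) (by simp) (by simpa using hi k)
    (by simpa using (hWk k).continuous.integrable_of_hasCompactSupport (hck k))
    (fun x _ => differentiableAt_const _)
    (fun x _ => (hWk k).differentiable (by norm_num) x)
  simpa using this

/-- The Riemannian divergence, in terms of the volume density. -/
theorem sum_fderiv_sqrt_det_mul {G : Model n → Matrix (Fin n) (Fin n) ℝ}
    {Z : Model n → Fin n → ℝ} {p : Model n} (hG : DifferentiableAt ℝ G p)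
    (hZ : DifferentiableAt ℝ Z p) (hpos : 0 < (G p).det) (hsymm : (G p).IsSymm) :
    ∑ k, fderiv ℝ (fun q => Real.sqrt (G q).det * Z q k) p (stdVec k) =
      (1 / 2) * (Real.sqrt (G p).det * matrixInner (G p)⁻¹
        (lieMatrix (G p) (fun k => fderiv ℝ G p (stdVec k)) (Z p) (jacobian Z p)) (G p)) := by
  have hu : IsUnit (G p).det := isUnit_iff_ne_zero.mpr hpos.ne'
  have hP : (G p)⁻¹.IsSymm := by
    rw [Matrix.IsSymm, Matrix.transpose_nonsing_inv, hsymm]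
  rw [matrixInner_lieMatrix_self hsymm hP (Matrix.nonsing_inv_mul _ hu)]
  have hk : ∀ k, fderiv ℝ (fun q => Real.sqrt (G q).det * Z q k) p (stdVec k) =
      (1 / 2) * (Real.sqrt (G p).det * (Z p k * ((G p)⁻¹ * fderiv ℝ G p (stdVec k)).trace)) +
        Real.sqrt (G p).det * jacobian Z p k k := fun k => by
    have hZk : DifferentiableAt ℝ (fun q => Z q k) p := (differentiableAt_pi.mp hZ) k
    have hZ' : fderiv ℝ (fun q => Z q k) p (stdVec k) = jacobian Z p k k := by
      have := (hasFDerivAt_pi'.mp hZ.hasFDerivAt k).fderiv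
      rw [this]; rfl
    have hdet : DifferentiableAt ℝ (fun q => (G q).det) p := (differentiable_det (G p)).comp p hG
    have h1 := (hdet.sqrt hpos.ne').mul hZk
    have h2 := h1.hasFDerivAt.hasLineDerivAt (stdVec k)
    have h3 : HasDerivAt (fun t : ℝ => (G (p + t • stdVec k)).det)
        ((G p).det * ((G p)⁻¹ * fderiv ℝ G p (stdVec k)).trace) 0 := by
      have := hasDerivAt_det (hG.hasFDerivAt.hasLineDerivAt (stdVec k)) (by simpa using hu)
      refine this.congr_deriv ?_
      simp only [zero_smul, add_zero]
      rfl
    have h4 := (h3.sqrt (by simpa using hpos.ne')).fun_mul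
      (hZk.hasFDerivAt.hasLineDerivAt (stdVec k))
    refine (h2.unique h4).trans ?_
    rw [hZ']
    simp only [zero_smul, add_zero]
    -- Rewrites the factor `det / (2 √det)` from the derivative of the square root as `½ √det`.
    have h5 : Real.sqrt (G p).det * Real.sqrt (G p).det = (G p).det := Real.mul_self_sqrt hpos.le
    have h6 : Real.sqrt (G p).det ≠ 0 := (Real.sqrt_pos.mpr hpos).ne'
    field_simp
    rw [sq, h5]
    ring
  rw [Finset.sum_congr rfl fun k _ => hk k, Finset.sum_add_distrib, ← Finset.mul_sum,
    ← Finset.mul_sum, ← Finset.mul_sum]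
  have : ∑ k, jacobian Z p k k = (jacobian Z p).trace := rfl
  rw [this]
  ring

end VectorCalculus

/-! ### Preferred charts: transition rules, components and invariance of `⟨L_X τ, h⟩`. -/

section Coordinates

variable {n : ℕ} {M : Type*} [TopologicalSpace M] [ChartedSpace (Model n) M]

open scoped Matrix.Norms.Operator

theorem point_extChartAt {x y : M} (hy : y ∈ (extChartAt 𝓘(ℝ, Model n) x).source) :
    point x (extChartAt 𝓘(ℝ, Model n) x y) = y :=
  (extChartAt 𝓘(ℝ, Model n) x).left_inv hy

theorem mapsTo_point (x : M) : MapsTo (point x) (extChartAt 𝓘(ℝ, Model n) x).target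
    (extChartAt 𝓘(ℝ, Model n) x).source :=
  (extChartAt 𝓘(ℝ, Model n) x).mapsTo_symm

theorem coords_mem_target (x : M) : coords x ∈ (extChartAt 𝓘(ℝ, Model n) x).target :=
  mem_extChartAt_target x

/-- The transition map between the charts selected by `x` and `x'`. -/
def transition (x x' : M) : Model n → Model n :=
  extChartAt 𝓘(ℝ, Model n) x' ∘ (extChartAt 𝓘(ℝ, Model n) x).symm

theorem transition_apply {x x' y : M} (hy : y ∈ (extChartAt 𝓘(ℝ, Model n) x).source) :
    transition x x' (extChartAt 𝓘(ℝ, Model n) x y) = extChartAt 𝓘(ℝ, Model n) x' y :=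
  congrArg _ (point_extChartAt hy)

theorem eventually_symm_mem {x x' y : M} (hy : y ∈ (extChartAt 𝓘(ℝ, Model n) x).source)
    (hy' : y ∈ (extChartAt 𝓘(ℝ, Model n) x').source) :
    ∀ᶠ q in 𝓝 (extChartAt 𝓘(ℝ, Model n) x y), q ∈ (extChartAt 𝓘(ℝ, Model n) x).target ∧
      point x q ∈ (extChartAt 𝓘(ℝ, Model n) x').source := by
  have h1 : (extChartAt 𝓘(ℝ, Model n) x).target ∈ 𝓝 (extChartAt 𝓘(ℝ, Model n) x y) :=
    (isOpen_extChartAt_target x).mem_nhds ((extChartAt 𝓘(ℝ, Model n) x).map_source hy)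
  have h2 : ContinuousAt (point x) (extChartAt 𝓘(ℝ, Model n) x y) :=
    (continuousOn_extChartAt_symm x).continuousAt h1
  refine (eventually_of_mem h1 fun _ => id).and (h2.eventually ?_)
  rw [point_extChartAt hy]
  exact (isOpen_extChartAt_source x').mem_nhds hy'

variable [IsManifold 𝓘(ℝ, Model n) ∞ M]

theorem comps_extChartAt (τ : BilinField n M) {x y : M}
    (hy : y ∈ (extChartAt 𝓘(ℝ, Model n) x).source) (i j : Fin n) :
    comps τ x (extChartAt 𝓘(ℝ, Model n) x y) i j = τ y (coordVec x y i) (coordVec x y j) := by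
  rw [comps, point_extChartAt hy, Matrix.of_apply]

theorem vecComps_extChartAt (X : VecField n M) {x y : M}
    (hy : y ∈ (extChartAt 𝓘(ℝ, Model n) x).source) (i : Fin n) :
    vecComps X x (extChartAt 𝓘(ℝ, Model n) x y) i = coordCovec x y i (X y) := by
  rw [vecComps, point_extChartAt hy]

theorem mem_baseSet {x y : M} (hy : y ∈ (extChartAt 𝓘(ℝ, Model n) x).source) :
    y ∈ (trivializationAt (Model n) (TangentSpace 𝓘(ℝ, Model n)) x).baseSet := by
  rwa [TangentBundle.trivializationAt_baseSet, ← extChartAt_source 𝓘(ℝ, Model n)]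

theorem coordCovec_coordVec {x y : M} (hy : y ∈ (extChartAt 𝓘(ℝ, Model n) x).source)
    (i j : Fin n) : coordCovec x y i (coordVec x y j) = if i = j then 1 else 0 := by
  have := (trivializationAt (Model n) (TangentSpace 𝓘(ℝ, Model n)) x).continuousLinearMapAt_symmL
    (R := ℝ) (mem_baseSet hy) (EuclideanSpace.single j 1)
  refine (congrArg (fun v : Model n => v i) this).trans ?_
  simp

theorem sum_coordCovec_smul_coordVec {x y : M} (hy : y ∈ (extChartAt 𝓘(ℝ, Model n) x).source)
    (v : Tan n y) : ∑ i, coordCovec x y i v • coordVec x y i = v := by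
  have := (trivializationAt (Model n) (TangentSpace 𝓘(ℝ, Model n)) x).symmL_continuousLinearMapAt
    (R := ℝ) (mem_baseSet hy) v
  conv_rhs => rw [← this]
  have h2 := map_toLp_eq_sum
    ((trivializationAt (Model n) (TangentSpace 𝓘(ℝ, Model n)) x).symmL ℝ y)
    (fun i => coordCovec x y i v)
  exact h2.symm

/-- The Jacobian matrix of the transition map. -/
def transitionMatrix (x x' : M) (p : Model n) : Matrix (Fin n) (Fin n) ℝ :=
  linMatrix (fderiv ℝ (transition x x') p)

theorem contDiffAt_transition {x x' y : M} (hy : y ∈ (extChartAt 𝓘(ℝ, Model n) x).source)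
    (hy' : y ∈ (extChartAt 𝓘(ℝ, Model n) x').source) :
    ContDiffAt ℝ 2 (transition x x') (extChartAt 𝓘(ℝ, Model n) x y) := by
  have h' : extChartAt 𝓘(ℝ, Model n) x y ∈ ((extChartAt 𝓘(ℝ, Model n) x).symm ≫
      (extChartAt 𝓘(ℝ, Model n) x')).source := by
    rw [PartialEquiv.trans_source'', PartialEquiv.symm_symm, PartialEquiv.symm_target]
    exact mem_image_of_mem _ ⟨hy, hy'⟩
  have := contDiffWithinAt_ext_coord_change (I := 𝓘(ℝ, Model n)) (n := 2) x' x h'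
  rwa [ModelWithCorners.range_eq_univ, contDiffWithinAt_univ] at this

theorem fderiv_transition {x x' y : M} :
    fderiv ℝ (transition x x') (extChartAt 𝓘(ℝ, Model n) x y) =
      tangentCoordChange 𝓘(ℝ, Model n) x x' y := by
  rw [tangentCoordChange_def]
  simp [fderivWithin_univ, transition]

theorem coordCovec_coordVec_transition {x x' y : M}
    (hy : y ∈ (extChartAt 𝓘(ℝ, Model n) x).source)
    (hy' : y ∈ (extChartAt 𝓘(ℝ, Model n) x').source) (a i : Fin n) :
    coordCovec x' y a (coordVec x y i) =
      transitionMatrix x x' (extChartAt 𝓘(ℝ, Model n) x y) a i := by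
  have h1 : y ∈ (chartAt (Model n) x).source := by rwa [← extChartAt_source 𝓘(ℝ, Model n)]
  have h2 : y ∈ (chartAt (Model n) x').source := by rwa [← extChartAt_source 𝓘(ℝ, Model n)]
  -- `TangentSpace` at `y` is the model space seen through the preferred chart at `y`; the cocycle
  -- rule `x → y → x'` removes this intermediate chart.
  have h3 := tangentCoordChange_comp (I := 𝓘(ℝ, Model n)) (w := x) (x := y) (y := x') (z := y)
    (v := EuclideanSpace.single i 1) ⟨⟨hy, mem_extChartAt_source y⟩, hy'⟩
  unfold coordCovec coordVec transitionMatrix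
  rw [TangentBundle.continuousLinearMapAt_trivializationAt_eq_core h2,
    TangentBundle.symmL_trivializationAt_eq_core h1, fderiv_transition]
  exact congrArg (fun v : Model n => v a) h3

theorem coordVec_transition {x x' y : M} (hy : y ∈ (extChartAt 𝓘(ℝ, Model n) x).source)
    (hy' : y ∈ (extChartAt 𝓘(ℝ, Model n) x').source) (i : Fin n) :
    coordVec x y i =
      ∑ a, transitionMatrix x x' (extChartAt 𝓘(ℝ, Model n) x y) a i • coordVec x' y a := by
  conv_lhs => rw [← sum_coordCovec_smul_coordVec hy' (coordVec x y i)]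
  simp only [coordCovec_coordVec_transition hy hy']

theorem comps_transition (τ : BilinField n M) {x x' y : M}
    (hy : y ∈ (extChartAt 𝓘(ℝ, Model n) x).source)
    (hy' : y ∈ (extChartAt 𝓘(ℝ, Model n) x').source) :
    comps τ x (extChartAt 𝓘(ℝ, Model n) x y) =
      (transitionMatrix x x' (extChartAt 𝓘(ℝ, Model n) x y))ᵀ *
        comps τ x' (extChartAt 𝓘(ℝ, Model n) x' y) *
        transitionMatrix x x' (extChartAt 𝓘(ℝ, Model n) x y) := by
  ext i j
  rw [comps_extChartAt τ hy]
  simp only [coordVec_transition hy hy', Matrix.mul_apply, Matrix.transpose_apply, map_sum,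
    map_smul, comps_extChartAt τ hy', _root_.sum_apply, _root_.smul_apply, smul_eq_mul,
    Finset.sum_mul, Finset.mul_sum]
  refine Finset.sum_congr rfl fun a _ => Finset.sum_congr rfl fun b _ => by ring

theorem vecComps_transition (X : VecField n M) {x x' y : M}
    (hy : y ∈ (extChartAt 𝓘(ℝ, Model n) x).source)
    (hy' : y ∈ (extChartAt 𝓘(ℝ, Model n) x').source) :
    vecComps X x' (extChartAt 𝓘(ℝ, Model n) x' y) =
      transitionMatrix x x' (extChartAt 𝓘(ℝ, Model n) x y) *ᵥ
        vecComps X x (extChartAt 𝓘(ℝ, Model n) x y) := by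
  ext a
  rw [vecComps_extChartAt X hy']
  conv_lhs => rw [← sum_coordCovec_smul_coordVec hy (X y)]
  simp only [map_sum, map_smul, coordCovec_coordVec_transition hy hy', Matrix.mulVec, dotProduct,
    smul_eq_mul, vecComps_extChartAt X hy]
  exact Finset.sum_congr rfl fun i _ => mul_comm _ _

theorem transitionMatrix_mul {x x' y : M} (hy : y ∈ (extChartAt 𝓘(ℝ, Model n) x).source)
    (hy' : y ∈ (extChartAt 𝓘(ℝ, Model n) x').source) :
    transitionMatrix x x' (extChartAt 𝓘(ℝ, Model n) x y) *
      transitionMatrix x' x (extChartAt 𝓘(ℝ, Model n) x' y) = 1 := by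
  rw [transitionMatrix, transitionMatrix, ← linMatrix_comp, ← linMatrix_id, fderiv_transition,
    fderiv_transition]
  congr 1
  ext1 v
  rw [ContinuousLinearMap.comp_apply, tangentCoordChange_comp ⟨⟨hy', hy⟩, hy'⟩,
    tangentCoordChange_self hy', ContinuousLinearMap.id_apply]

theorem isUnit_det_transitionMatrix {x x' y : M} (hy : y ∈ (extChartAt 𝓘(ℝ, Model n) x).source)
    (hy' : y ∈ (extChartAt 𝓘(ℝ, Model n) x').source) :
    IsUnit (transitionMatrix x x' (extChartAt 𝓘(ℝ, Model n) x y)).det := by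
  have := congrArg Matrix.det (transitionMatrix_mul hy hy')
  rw [Matrix.det_mul, Matrix.det_one] at this
  exact IsUnit.of_mul_eq_one _ this

/-- A field of bilinear forms whose components are of class `C¹` in every preferred chart. -/
def BilinField.ChartC1 (τ : BilinField n M) : Prop :=
  ∀ x, ContDiffOn ℝ 1 (comps τ x) (extChartAt 𝓘(ℝ, Model n) x).target

/-- A vector field whose components are of class `C¹` in every preferred chart. -/
def VecField.ChartC1 (X : VecField n M) : Prop :=
  ∀ x, ContDiffOn ℝ 1 (vecComps X x) (extChartAt 𝓘(ℝ, Model n) x).target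

theorem contDiffOn_matrix {E : Type*} [NormedAddCommGroup E] [NormedSpace ℝ E]
    {A : E → Matrix (Fin n) (Fin n) ℝ} {s : Set E} {m : ℕ∞ω}
    (h : ∀ i j, ContDiffOn ℝ m (fun q => A q i j) s) : ContDiffOn ℝ m A s := by
  have : A = fun q => ∑ i, ∑ j, A q i j • Matrix.single i j (1 : ℝ) := by
    ext1 q
    conv_lhs => rw [Matrix.matrix_eq_sum_single (A q)]
    simp [Matrix.smul_single]
  rw [this]
  exact ContDiffOn.sum fun i _ => ContDiffOn.sum fun j _ => (h i j).smul contDiffOn_const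

theorem contMDiffOn_coordVec (x : M) (i : Fin n) :
    ContMDiffOn 𝓘(ℝ, Model n) 𝓘(ℝ, Model n).tangent 1
      (fun y : M => (⟨y, coordVec x y i⟩ : TangentBundle 𝓘(ℝ, Model n) M))
      (extChartAt 𝓘(ℝ, Model n) x).source := by
  have h0 := (trivializationAt (Model n) (TangentSpace 𝓘(ℝ, Model n)) x).contMDiffOn_section_iff
    (IB := 𝓘(ℝ, Model n)) (n := 1) (s := fun y => coordVec x y i)
    (isOpen_extChartAt_source (I := 𝓘(ℝ, Model n)) x) fun y hy => mem_baseSet hy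
  refine h0.mpr ?_
  refine (contMDiffOn_const (c := (EuclideanSpace.single i (1 : ℝ) : Model n))).congr fun y hy => ?_
  have := (trivializationAt (Model n) (TangentSpace 𝓘(ℝ, Model n)) x).continuousLinearMapAt_symmL
    (R := ℝ) (mem_baseSet hy) (EuclideanSpace.single i 1)
  rw [Bundle.Trivialization.continuousLinearMapAt_apply_of_mem] at this
  · exact this
  · exact mem_baseSet hy

/-- The components are values of `τ` on the coordinate frame, which is itself a C¹ section over the
chart domain. -/
theorem BilinField.IsC1.chartC1 {τ : BilinField n M} (hτ : τ.IsC1) : τ.ChartC1 := fun x => by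
  refine contDiffOn_matrix fun i j => contMDiffOn_iff_contDiffOn.mp ?_
  have h1 : ContMDiffOn 𝓘(ℝ, Model n) 𝓘(ℝ, ℝ) 1
      (fun y => τ y (coordVec x y i) (coordVec x y j)) (extChartAt 𝓘(ℝ, Model n) x).source := by
    have := ContMDiffOn.clm_bundle_apply₂ (E₃ := Bundle.Trivial M ℝ) (F₃ := ℝ)
      (ψ := τ) (ContMDiff.contMDiffOn hτ) (contMDiffOn_coordVec x i) (contMDiffOn_coordVec x j)
    intro y hy
    have h2 := this y hy
    rw [Bundle.contMDiffWithinAt_totalSpace] at h2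
    exact h2.2
  exact h1.comp (contMDiffOn_extChartAt_symm x) (mapsTo_point x)

theorem VecField.IsC1.chartC1 {X : VecField n M} (hX : X.IsC1) : X.ChartC1 := fun x => by
  have h0 := ((trivializationAt (Model n) (TangentSpace 𝓘(ℝ, Model n)) x).contMDiffOn_section_iff
    (IB := 𝓘(ℝ, Model n)) (n := 1) (s := X)
    (isOpen_extChartAt_source (I := 𝓘(ℝ, Model n)) x) fun y hy => mem_baseSet hy).mp
      (ContMDiff.contMDiffOn hX)
  have h1 := h0.comp (contMDiffOn_extChartAt_symm x) (mapsTo_point x)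
  have h2 := contMDiffOn_iff_contDiffOn.mp h1
  refine contDiffOn_pi.mpr fun i => ?_
  refine (((EuclideanSpace.proj i : Model n →L[ℝ] ℝ)).contDiff.comp_contDiffOn h2).congr
    fun p hp => ?_
  exact congrArg (fun v : Model n => v i)
    (Bundle.Trivialization.continuousLinearMapAt_apply_of_mem (R := ℝ)
      (trivializationAt (Model n) (TangentSpace 𝓘(ℝ, Model n)) x)
      (mem_baseSet (mapsTo_point x hp)) (X (point x p)))

theorem BilinField.ChartC1.contDiffAt {τ : BilinField n M} (hτ : τ.ChartC1) {x : M} {p : Model n}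
    (hp : p ∈ (extChartAt 𝓘(ℝ, Model n) x).target) : ContDiffAt ℝ 1 (comps τ x) p :=
  (hτ x).contDiffAt ((isOpen_extChartAt_target x).mem_nhds hp)

theorem VecField.ChartC1.contDiffAt {X : VecField n M} (hX : X.ChartC1) {x : M} {p : Model n}
    (hp : p ∈ (extChartAt 𝓘(ℝ, Model n) x).target) : ContDiffAt ℝ 1 (vecComps X x) p :=
  (hX x).contDiffAt ((isOpen_extChartAt_target x).mem_nhds hp)

theorem BilinField.IsSymm.comps {τ : BilinField n M} (hτ : τ.IsSymm) (x : M) (p : Model n) :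
    (comps τ x p).IsSymm := by
  ext i j
  exact hτ _ _ _

theorem fderiv_matrix_entry {E : Type*} [NormedAddCommGroup E] [NormedSpace ℝ E]
    {A : E → Matrix (Fin n) (Fin n) ℝ} {p : E} (h : DifferentiableAt ℝ A p) (i j : Fin n) (v : E) :
    fderiv ℝ (fun q => A q i j) p v = fderiv ℝ A p v i j := by
  have := ((Matrix.entryLinearMap ℝ ℝ i j).toContinuousLinearMap.hasFDerivAt.comp p
    h.hasFDerivAt).fderiv
  exact congrArg (fun L : E →L[ℝ] ℝ => L v) this

theorem fderiv_vec_entry {E : Type*} [NormedAddCommGroup E] [NormedSpace ℝ E]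
    {X : E → Fin n → ℝ} {p : E} (h : DifferentiableAt ℝ X p) (i : Fin n) (v : E) :
    fderiv ℝ (fun q => X q i) p v = fderiv ℝ X p v i := by
  rw [(hasFDerivAt_pi'.mp h.hasFDerivAt i).fderiv]
  rfl

/-- The matrix of the Lie derivative, in the chart selected by `x`. -/
def chartLie (X : VecField n M) (τ : BilinField n M) (x : M) (p : Model n) :
    Matrix (Fin n) (Fin n) ℝ :=
  lieMatrix (comps τ x p) (fun k => fderiv ℝ (comps τ x) p (stdVec k)) (vecComps X x p)
    (jacobian (vecComps X x) p)

theorem lieDerivComps_eq_chartLie {X : VecField n M} {τ : BilinField n M} (hX : X.ChartC1)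
    (hτ : τ.ChartC1) {x : M} {p : Model n} (hp : p ∈ (extChartAt 𝓘(ℝ, Model n) x).target)
    (i j : Fin n) : lieDerivComps X τ x p i j = chartLie X τ x p i j := by
  have h1 := (hτ.contDiffAt hp).differentiableAt (by norm_num)
  have h2 := (hX.contDiffAt hp).differentiableAt (by norm_num)
  simp only [lieDerivComps, partialDeriv, fderiv_matrix_entry h1, fderiv_vec_entry h2, chartLie,
    lieMatrix, Finset.sum_add_distrib, Matrix.add_apply, Matrix.mul_apply, Matrix.transpose_apply,
    jacobian, Matrix.of_apply, Matrix.sum_apply, Matrix.smul_apply, smul_eq_mul]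
  congr 2
  exact Finset.sum_congr rfl fun k _ => mul_comm _ _

/-- `lieDeriv` uses a different chart at each point, so its definition gives the components only at
`coords x`. Passing to one fixed chart requires the covariance of the Lie derivative. -/
theorem comps_lieDeriv {X : VecField n M} {τ : BilinField n M} (hX : X.ChartC1) (hτ : τ.ChartC1)
    (x : M) : comps (lieDeriv X τ) x (coords x) = chartLie X τ x (coords x) := by
  ext i j
  have hx : point x (coords x) = x :=
    point_extChartAt (n := n) (mem_extChartAt_source x)
  rw [← lieDerivComps_eq_chartLie hX hτ (coords_mem_target x), comps, hx, Matrix.of_apply]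
  simp only [lieDeriv, _root_.sum_apply, _root_.smul_apply,
    ContinuousLinearMap.smulRight_apply, coordCovec_coordVec (mem_extChartAt_source x), smul_eq_mul]
  simp

/-- The inner product `⟨L_X τ, h⟩`, in the chart selected by `x`. -/
def chartLieInner (g : BilinField n M) (X : VecField n M) (τ h : BilinField n M) (x : M)
    (p : Model n) : ℝ :=
  matrixInner (comps g x p)⁻¹ (chartLie X τ x p) (comps h x p)

theorem tensorInner_eq_matrixInner (g a b : BilinField n M) (x : M) :
    tensorInner g a b x =
      matrixInner (comps g x (coords x))⁻¹ (comps a x (coords x)) (comps b x (coords x)) :=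
  (matrixInner_eq_sum _ _ _).symm

theorem tensorInner_lieDeriv_eq_coords (g : BilinField n M) {X : VecField n M}
    {τ : BilinField n M} (h : BilinField n M) (hX : X.ChartC1) (hτ : τ.ChartC1) (x : M) :
    tensorInner g (lieDeriv X τ) h x = chartLieInner g X τ h x (coords x) := by
  rw [tensorInner_eq_matrixInner, comps_lieDeriv hX hτ, chartLieInner]

/-- All three matrices change by congruence with the same Jacobian matrix, the Lie derivative by
`lieMatrix_congruence`; the full contraction is therefore invariant. -/
theorem chartLieInner_transition (g : BilinField n M) {X : VecField n M} {τ : BilinField n M}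
    (h : BilinField n M) (hX : X.ChartC1) (hτ : τ.ChartC1) {x x' y : M}
    (hy : y ∈ (extChartAt 𝓘(ℝ, Model n) x).source)
    (hy' : y ∈ (extChartAt 𝓘(ℝ, Model n) x').source) :
    chartLieInner g X τ h x (extChartAt 𝓘(ℝ, Model n) x y) =
      chartLieInner g X τ h x' (extChartAt 𝓘(ℝ, Model n) x' y) := by
  have hp := (extChartAt 𝓘(ℝ, Model n) x).map_source hy
  have hp' := (extChartAt 𝓘(ℝ, Model n) x').map_source hy'
  have hev : ∀ᶠ q in 𝓝 (extChartAt 𝓘(ℝ, Model n) x y), ∃ z,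
      z ∈ (extChartAt 𝓘(ℝ, Model n) x).source ∧ z ∈ (extChartAt 𝓘(ℝ, Model n) x').source ∧
      q = extChartAt 𝓘(ℝ, Model n) x z :=
    (eventually_symm_mem hy hy').mono fun q hq =>
      ⟨point x q, mapsTo_point x hq.1, hq.2, ((extChartAt 𝓘(ℝ, Model n) x).right_inv hq.1).symm⟩
  have hlie : chartLie X τ x (extChartAt 𝓘(ℝ, Model n) x y) =
      (transitionMatrix x x' (extChartAt 𝓘(ℝ, Model n) x y))ᵀ *
        chartLie X τ x' (extChartAt 𝓘(ℝ, Model n) x' y) *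
        transitionMatrix x x' (extChartAt 𝓘(ℝ, Model n) x y) := by
    have := lieMatrix_congruence (T := comps τ x) (T' := comps τ x') (X := vecComps X x)
      (X' := vecComps X x') (Φ := transition x x') (p := extChartAt 𝓘(ℝ, Model n) x y)
      (contDiffAt_transition hy hy')
      (by rw [transition_apply hy]; exact (hτ.contDiffAt hp').differentiableAt (by norm_num))
      ((hX.contDiffAt hp).differentiableAt (by norm_num))
      (by rw [transition_apply hy]; exact (hX.contDiffAt hp').differentiableAt (by norm_num))
      (hev.mono ?_) (hev.mono ?_)
    · rw [transition_apply hy] at this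
      exact this
    · rintro q ⟨z, hz, hz', rfl⟩
      dsimp only
      rw [transition_apply hz]
      exact comps_transition τ hz hz'
    · rintro q ⟨z, hz, hz', rfl⟩
      dsimp only
      rw [transition_apply hz]
      exact vecComps_transition X hz hz'
  rw [chartLieInner, hlie, comps_transition g hy hy', comps_transition h hy hy', inv_congruence,
    matrixInner_congruence (isUnit_det_transitionMatrix hy hy'), chartLieInner]

theorem tensorInner_lieDeriv_eq (g : BilinField n M) {X : VecField n M} {τ : BilinField n M}
    (h : BilinField n M) (hX : X.ChartC1) (hτ : τ.ChartC1) {x y : M}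
    (hy : y ∈ (extChartAt 𝓘(ℝ, Model n) x).source) :
    tensorInner g (lieDeriv X τ) h y =
      chartLieInner g X τ h x (extChartAt 𝓘(ℝ, Model n) x y) := by
  rw [tensorInner_lieDeriv_eq_coords g h hX hτ]
  exact chartLieInner_transition g h hX hτ (mem_extChartAt_source y) hy

end Coordinates

/-! ### The Riemannian volume measure in a chart. -/

section Volume

variable {n : ℕ} {M : Type*} [TopologicalSpace M] [ChartedSpace (Model n) M]

open scoped Matrix.Norms.Operator

theorem image_transition (x x' : M) (S : Set M) :
    transition x x' '' ((extChartAt 𝓘(ℝ, Model n) x).target ∩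
        point x ⁻¹' (S ∩ (extChartAt 𝓘(ℝ, Model n) x').source)) =
      (extChartAt 𝓘(ℝ, Model n) x').target ∩
        point x' ⁻¹' (S ∩ (extChartAt 𝓘(ℝ, Model n) x).source) := by
  ext q
  constructor
  · rintro ⟨p, ⟨hp, hpS, hp'⟩, rfl⟩
    have h1 : point x' (transition x x' p) = point x p := point_extChartAt hp'
    refine ⟨(extChartAt 𝓘(ℝ, Model n) x').map_source hp', ?_⟩
    rw [mem_preimage, h1]
    exact ⟨hpS, mapsTo_point x hp⟩
  · rintro ⟨hq, hqS, hq'⟩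
    have h1 : point x (extChartAt 𝓘(ℝ, Model n) x (point x' q)) = point x' q :=
      point_extChartAt hq'
    refine ⟨extChartAt 𝓘(ℝ, Model n) x (point x' q),
      ⟨(extChartAt 𝓘(ℝ, Model n) x).map_source hq', ?_⟩, ?_⟩
    · rw [mem_preimage, h1]
      exact ⟨hqS, mapsTo_point x' hq⟩
    · change extChartAt 𝓘(ℝ, Model n) x' (point x _) = q
      rw [h1]
      exact (extChartAt 𝓘(ℝ, Model n) x').right_inv hq

section Density

variable [IsManifold 𝓘(ℝ, Model n) ∞ M]

/-- The volume density `√(det g)` in the chart selected by `x`. -/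
def density (g : BilinField n M) (x : M) (p : Model n) : ℝ := Real.sqrt (comps g x p).det

/-- Take square roots in `det (Aᵀ G A) = (det A)² det G`. -/
theorem abs_det_mul_density (g : BilinField n M) {x x' y : M}
    (hy : y ∈ (extChartAt 𝓘(ℝ, Model n) x).source)
    (hy' : y ∈ (extChartAt 𝓘(ℝ, Model n) x').source) :
    |(fderiv ℝ (transition x x') (extChartAt 𝓘(ℝ, Model n) x y)).det| *
      density g x' (extChartAt 𝓘(ℝ, Model n) x' y) =
      density g x (extChartAt 𝓘(ℝ, Model n) x y) := by
  rw [density, density, comps_transition g hy hy', Matrix.det_mul, Matrix.det_mul,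
    Matrix.det_transpose, mul_right_comm, Real.sqrt_mul (mul_self_nonneg _),
    Real.sqrt_mul_self_eq_abs, transitionMatrix, det_linMatrix]

theorem continuousOn_density {g : BilinField n M} (hg : g.ChartC1) (x : M) :
    ContinuousOn (density g x) (extChartAt 𝓘(ℝ, Model n) x).target :=
  (Real.continuous_sqrt.comp contDiff_det.continuous).comp_continuousOn (hg x).continuousOn

end Density

variable [MeasurableSpace M] [BorelSpace M]

theorem measurableSet_target_inter_preimage (x : M) {S : Set M} (hS : MeasurableSet S) :
    MeasurableSet ((extChartAt 𝓘(ℝ, Model n) x).target ∩ point x ⁻¹' S) := by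
  have hc : Continuous fun p : (extChartAt 𝓘(ℝ, Model n) x).target => point x (p : Model n) :=
    continuousOn_iff_continuous_domRestrict.mp (continuousOn_extChartAt_symm x)
  have := (isOpen_extChartAt_target (I := 𝓘(ℝ, Model n)) x).measurableSet.subtype_image
    (hc.measurable hS)
  convert this using 1
  ext p
  simp [and_comm]

variable [IsManifold 𝓘(ℝ, Model n) ∞ M]

theorem aemeasurable_point (g : BilinField n M) (x : M) : AEMeasurable (point x)
    ((volume.restrict (extChartAt 𝓘(ℝ, Model n) x).target).withDensity
      fun p => ENNReal.ofReal (Real.sqrt (comps g x p).det)) :=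
  AEMeasurable.mono_ac ((continuousOn_extChartAt_symm x).aemeasurable
    (isOpen_extChartAt_target x).measurableSet) (withDensity_absolutelyContinuous _ _)

theorem chartVolume_apply (g : BilinField n M) (x : M) {S : Set M} (hS : MeasurableSet S) :
    chartVolume g x S = ∫⁻ p in (extChartAt 𝓘(ℝ, Model n) x).target ∩ point x ⁻¹' S,
      ENNReal.ofReal (density g x p) := by
  rw [chartVolume, Measure.map_apply_of_aemeasurable (aemeasurable_point g x) hS, withDensity_apply',
    Measure.restrict_restrict' (isOpen_extChartAt_target x).measurableSet, inter_comm]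
  rfl

/-- Change of variables on the overlap of the two charts. The inequality alone suffices to compute
the supremum defining the volume. -/
theorem chartVolume_restrict_le (g : BilinField n M) (x x' : M) :
    (chartVolume g x').restrict (extChartAt 𝓘(ℝ, Model n) x).source ≤ chartVolume g x := by
  refine Measure.le_iff.mpr fun S hS => ?_
  have hU := (isOpen_extChartAt_source (I := 𝓘(ℝ, Model n)) x).measurableSet
  have hU' := (isOpen_extChartAt_source (I := 𝓘(ℝ, Model n)) x').measurableSet
  rw [Measure.restrict_apply hS, chartVolume_apply g x' (hS.inter hU), ← image_transition,
    chartVolume_apply g x hS]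
  have hy : ∀ p ∈ (extChartAt 𝓘(ℝ, Model n) x).target ∩
      point x ⁻¹' (S ∩ (extChartAt 𝓘(ℝ, Model n) x').source), ∃ y,
      y ∈ (extChartAt 𝓘(ℝ, Model n) x).source ∧ y ∈ (extChartAt 𝓘(ℝ, Model n) x').source ∧
        p = extChartAt 𝓘(ℝ, Model n) x y := fun p hp =>
    ⟨point x p, mapsTo_point x hp.1, hp.2.2, ((extChartAt 𝓘(ℝ, Model n) x).right_inv hp.1).symm⟩
  have hD := measurableSet_target_inter_preimage (n := n) x (hS.inter hU')
  rw [lintegral_image_eq_lintegral_abs_det_fderiv_mul volume hD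
    (f' := fderiv ℝ (transition x x'))]
  · calc _ = ∫⁻ p in (extChartAt 𝓘(ℝ, Model n) x).target ∩
          point x ⁻¹' (S ∩ (extChartAt 𝓘(ℝ, Model n) x').source),
          ENNReal.ofReal (density g x p) := by
          refine setLIntegral_congr_fun hD fun p hp => ?_
          obtain ⟨y, hy1, hy2, rfl⟩ := hy p hp
          rw [← ENNReal.ofReal_mul (abs_nonneg _), transition_apply hy1,
            abs_det_mul_density g hy1 hy2]
      _ ≤ _ := lintegral_mono_set (inter_subset_inter_right _ fun p hp => hp.1)
  · intro p hp
    obtain ⟨y, hy1, hy2, rfl⟩ := hy p hp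
    exact ((contDiffAt_transition hy1 hy2).differentiableAt
      (by norm_num)).hasFDerivAt.hasFDerivWithinAt
  · intro p hp q hq hpq
    obtain ⟨y, hy1, hy2, rfl⟩ := hy p hp
    obtain ⟨z, hz1, hz2, rfl⟩ := hy q hq
    rw [transition_apply hy1, transition_apply hz1] at hpq
    rw [(extChartAt 𝓘(ℝ, Model n) x').injOn hy2 hz2 hpq]

theorem chartVolume_restrict_source (g : BilinField n M) (x : M) :
    (chartVolume g x).restrict (extChartAt 𝓘(ℝ, Model n) x).source = chartVolume g x := by
  refine Measure.ext fun S hS => ?_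
  have hU := (isOpen_extChartAt_source (I := 𝓘(ℝ, Model n)) x).measurableSet
  rw [Measure.restrict_apply hS, chartVolume_apply g x (hS.inter hU), chartVolume_apply g x hS]
  congr 2
  ext p
  exact ⟨fun hp => ⟨hp.1, hp.2.1⟩, fun hp => ⟨hp.1, hp.2, mapsTo_point x hp.1⟩⟩

/-- On the domain of a chart, the Riemannian volume is given by the volume density. -/
theorem riemannianVolume_restrict (g : BilinField n M) (x : M) :
    (riemannianVolume g).restrict (extChartAt 𝓘(ℝ, Model n) x).source = chartVolume g x := by
  have hU := (isOpen_extChartAt_source (I := 𝓘(ℝ, Model n)) x).measurableSet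
  have hle : ∀ y, chartVolume g y ≤ riemannianVolume g := fun y => le_iSup (chartVolume g) y
  apply le_antisymm
  -- The right-hand side bounds every chart measure: inside the domain of `x` by
  -- `chartVolume_restrict_le`, outside trivially. Hence it bounds the supremum, and restricting to
  -- the domain removes the second summand.
  · have h1 : riemannianVolume g ≤ chartVolume g x +
        (riemannianVolume g).restrict (extChartAt 𝓘(ℝ, Model n) x).sourceᶜ := by
      refine iSup_le fun y => ?_
      rw [← Measure.restrict_add_restrict_compl (μ := chartVolume g y) hU]
      exact add_le_add (chartVolume_restrict_le g x y)
        (Measure.restrict_mono_measure (hle y) _)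
    refine (Measure.restrict_mono_measure h1 _).trans ?_
    rw [Measure.restrict_add, Measure.restrict_restrict hU, inter_compl_self,
      Measure.restrict_empty, add_zero]
    exact Measure.restrict_le_self
  · rw [← chartVolume_restrict_source g x]
    exact Measure.restrict_mono_measure (hle x) _

theorem setIntegral_riemannianVolume {g : BilinField n M} (hg : g.ChartC1) (x : M) {f : M → ℝ}
    (hf : Continuous f) :
    ∫ y in (extChartAt 𝓘(ℝ, Model n) x).source, f y ∂(riemannianVolume g) =
      ∫ p in (extChartAt 𝓘(ℝ, Model n) x).target, density g x p * f (point x p) := by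
  rw [riemannianVolume_restrict, chartVolume, integral_map (aemeasurable_point g x)
    hf.aestronglyMeasurable, integral_withDensity_eq_integral_toReal_smul₀]
  · refine integral_congr_ae (Eventually.of_forall fun p => ?_)
    simp only [smul_eq_mul, density]
    rw [ENNReal.toReal_ofReal (Real.sqrt_nonneg _)]
  · exact ((continuousOn_density hg x).aemeasurable
      (isOpen_extChartAt_target x).measurableSet).ennreal_ofReal
  · exact Eventually.of_forall fun p => ENNReal.ofReal_lt_top

/-- The density is continuous, hence integrable on a compact coordinate neighbourhood. -/
theorem isLocallyFiniteMeasure_riemannianVolume {g : BilinField n M} (hg : g.ChartC1) :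
    IsLocallyFiniteMeasure (riemannianVolume g) := by
  refine ⟨fun x => ?_⟩
  obtain ⟨K, hK, hxK, hKt⟩ := exists_compact_subset (isOpen_extChartAt_target x)
    (mem_extChartAt_target (I := 𝓘(ℝ, Model n)) x)
  have hV : IsOpen ((extChartAt 𝓘(ℝ, Model n) x).source ∩
      extChartAt 𝓘(ℝ, Model n) x ⁻¹' interior K) :=
    (continuousOn_extChartAt x).isOpen_inter_preimage (isOpen_extChartAt_source x) isOpen_interior
  refine ⟨_, hV.mem_nhds ⟨mem_extChartAt_source x, hxK⟩, ?_⟩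
  have h1 := Measure.restrict_apply hV.measurableSet (μ := riemannianVolume g)
    (s := (extChartAt 𝓘(ℝ, Model n) x).source)
  rw [inter_right_comm, inter_self, riemannianVolume_restrict,
    chartVolume_apply g x hV.measurableSet] at h1
  rw [← h1]
  have h2 : IntegrableOn (density g x) K :=
    ((continuousOn_density hg x).mono hKt).integrableOn_compact hK
  refine lt_of_le_of_lt (lintegral_mono_set ?_) h2.lintegral_lt_top
  rintro p ⟨hp, hp1, hp2⟩
  have : extChartAt 𝓘(ℝ, Model n) x (point x p) = p := (extChartAt 𝓘(ℝ, Model n) x).right_inv hp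
  rw [mem_preimage, this] at hp2
  exact interior_subset hp2

end Volume

/-! ### The divergence theorem on a closed manifold. -/

section DivergenceTheorem

variable {n : ℕ} {M : Type*} [TopologicalSpace M] [ChartedSpace (Model n) M]
  [IsManifold 𝓘(ℝ, Model n) ∞ M]

open scoped Matrix.Norms.Operator

/-- A symmetric field of bilinear forms with components of class `C¹` and positive determinants. -/
structure BilinField.IsChartMetric (g : BilinField n M) : Prop where
  chartC1 : g.ChartC1
  symm : g.IsSymm
  det_pos : ∀ (x : M) (p : Model n), p ∈ (extChartAt 𝓘(ℝ, Model n) x).target →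
    0 < (comps g x p).det

theorem BilinField.IsChartMetric.isUnit_det {g : BilinField n M} (hg : g.IsChartMetric) {x : M}
    {p : Model n} (hp : p ∈ (extChartAt 𝓘(ℝ, Model n) x).target) : IsUnit (comps g x p).det :=
  isUnit_iff_ne_zero.mpr (hg.det_pos x p hp).ne'

theorem Metric.isChartMetric (γ : Metric n M) : BilinField.IsChartMetric (M := M) γ.inner where
  chartC1 := BilinField.IsC1.chartC1 γ.contMDiff
  symm := γ.symm
  det_pos := fun x p hp => by
    have hsymm : BilinField.IsSymm (M := M) γ.inner := γ.symm
    refine Matrix.PosDef.det_pos (Matrix.PosDef.of_dotProduct_mulVec_pos ?_ fun v hv => ?_)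
    · rw [Matrix.IsHermitian, Matrix.conjTranspose_eq_transpose_of_trivial]
      exact hsymm.comps x p
    · obtain ⟨y, hy, rfl⟩ : ∃ y, y ∈ (extChartAt 𝓘(ℝ, Model n) x).source ∧
          p = extChartAt 𝓘(ℝ, Model n) x y :=
        ⟨point x p, mapsTo_point x hp, ((extChartAt 𝓘(ℝ, Model n) x).right_inv hp).symm⟩
      -- The dual covectors show that the coordinate vectors are linearly independent.
      have h1 : ∑ i, v i • coordVec x y i ≠ 0 := fun h0 => hv <| by
        ext j
        have := congrArg (coordCovec x y j) h0
        simpa [coordCovec_coordVec hy] using this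
      refine lt_of_lt_of_eq (γ.pos y _ h1) ?_
      simp only [map_sum, map_smul, _root_.sum_apply, _root_.smul_apply, smul_eq_mul, dotProduct,
        Matrix.mulVec, Pi.star_apply, star_trivial, comps_extChartAt _ hy, Finset.mul_sum]
      rw [Finset.sum_comm]
      exact Finset.sum_congr rfl fun i _ => Finset.sum_congr rfl fun j _ => by ring

theorem continuousOn_chartLie {X : VecField n M} {τ : BilinField n M} (hX : X.ChartC1)
    (hτ : τ.ChartC1) (x : M) :
    ContinuousOn (chartLie X τ x) (extChartAt 𝓘(ℝ, Model n) x).target := by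
  have ho := isOpen_extChartAt_target (I := 𝓘(ℝ, Model n)) x
  have h1 := (hτ x).continuousOn_fderiv_of_isOpen ho (by norm_num)
  have h2 := (hX x).continuousOn_fderiv_of_isOpen ho (by norm_num)
  have hXc := (hX x).continuousOn
  have hτc := (hτ x).continuousOn
  have hJ : ContinuousOn (jacobian (vecComps X x)) (extChartAt 𝓘(ℝ, Model n) x).target := by
    refine continuousOn_pi.mpr fun a => continuousOn_pi.mpr fun i => ?_
    exact continuousOn_pi.mp (h2.clm_apply continuousOn_const) a
  refine ((continuousOn_finsetSum _ fun k _ => ?_).add ?_).add ?_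
  · exact (continuousOn_pi.mp hXc k).smul (h1.clm_apply continuousOn_const)
  · exact (Continuous.matrix_transpose continuous_id).comp_continuousOn hJ |>.mul hτc
  · exact hτc.mul hJ

theorem continuousOn_chartLieInner {g : BilinField n M} (hg : g.IsChartMetric) {X : VecField n M}
    {τ h : BilinField n M} (hX : X.ChartC1) (hτ : τ.ChartC1) (hh : h.ChartC1) (x : M) :
    ContinuousOn (chartLieInner g X τ h x) (extChartAt 𝓘(ℝ, Model n) x).target := by
  have hP : ContinuousOn (fun p => (comps g x p)⁻¹) (extChartAt 𝓘(ℝ, Model n) x).target :=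
    fun p hp => (contDiffAt_matrix_inv (hg.chartC1.contDiffAt hp)
      (hg.isUnit_det hp)).continuousAt.continuousWithinAt
  have ht : Continuous fun A : Matrix (Fin n) (Fin n) ℝ => Aᵀ :=
    Continuous.matrix_transpose continuous_id
  exact (Continuous.matrix_trace continuous_id).comp_continuousOn
    ((((ht.comp_continuousOn hP).mul (continuousOn_chartLie hX hτ x)).mul hP).mul
      (ht.comp_continuousOn (hh x).continuousOn))

theorem continuous_tensorInner_lieDeriv {g : BilinField n M} (hg : g.IsChartMetric)
    {X : VecField n M} {τ h : BilinField n M} (hX : X.ChartC1) (hτ : τ.ChartC1)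
    (hh : h.ChartC1) : Continuous fun y => tensorInner g (lieDeriv X τ) h y := by
  refine continuous_iff_continuousAt.mpr fun x => ?_
  have hx := (isOpen_extChartAt_source (I := 𝓘(ℝ, Model n)) x).mem_nhds (mem_extChartAt_source x)
  have h1 : ContinuousOn (fun y => chartLieInner g X τ h x (extChartAt 𝓘(ℝ, Model n) x y))
      (extChartAt 𝓘(ℝ, Model n) x).source :=
    (continuousOn_chartLieInner hg hX hτ hh x).comp (continuousOn_extChartAt x)
      (extChartAt 𝓘(ℝ, Model n) x).mapsTo
  exact (h1.continuousAt hx).congr (eventually_of_mem hx fun y hy =>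
    (tensorInner_lieDeriv_eq g h hX hτ hy).symm)

theorem vecComps_sum {ι : Type*} (s : Finset ι) (Z : ι → VecField n M) (x : M) (p : Model n) :
    vecComps (fun y => ∑ i ∈ s, Z i y) x p = ∑ i ∈ s, vecComps (Z i) x p := by
  ext k
  simp [vecComps, Finset.sum_apply]

theorem chartLie_sum {ι : Type*} (s : Finset ι) {Z : ι → VecField n M} (hZ : ∀ i, (Z i).ChartC1)
    (τ : BilinField n M) {x : M} {p : Model n} (hp : p ∈ (extChartAt 𝓘(ℝ, Model n) x).target) :
    chartLie (fun y => ∑ i ∈ s, Z i y) τ x p = ∑ i ∈ s, chartLie (Z i) τ x p := by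
  have h1 : jacobian (vecComps (fun y => ∑ i ∈ s, Z i y) x) p =
      ∑ i ∈ s, jacobian (vecComps (Z i) x) p := by
    have h2 : vecComps (fun y => ∑ i ∈ s, Z i y) x = fun p => ∑ i ∈ s, vecComps (Z i) x p :=
      funext fun p => vecComps_sum s Z x p
    have h3 := fderiv_fun_sum (u := s) (A := fun i => vecComps (Z i) x) (x := p) (𝕜 := ℝ)
      fun i _ => ((hZ i).contDiffAt hp).differentiableAt (by norm_num)
    ext a k
    rw [jacobian, h2, h3]
    simp [jacobian, Matrix.sum_apply, Finset.sum_apply]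
  simp only [chartLie, lieMatrix, h1, vecComps_sum, Finset.sum_apply, Finset.sum_smul,
    Matrix.transpose_sum, Finset.sum_mul, Finset.mul_sum, Finset.sum_add_distrib]
  rw [Finset.sum_comm]

theorem tensorInner_lieDeriv_sum {ι : Type*} (s : Finset ι) (g : BilinField n M)
    {Z : ι → VecField n M} (hZ : ∀ i, (Z i).ChartC1)
    (hsum : VecField.ChartC1 fun y => ∑ i ∈ s, Z i y) {τ : BilinField n M} (hτ : τ.ChartC1)
    (h : BilinField n M) (y : M) :
    tensorInner g (lieDeriv (fun y => ∑ i ∈ s, Z i y) τ) h y =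
      ∑ i ∈ s, tensorInner g (lieDeriv (Z i) τ) h y := by
  simp only [tensorInner_lieDeriv_eq_coords g h hsum hτ,
    fun i => tensorInner_lieDeriv_eq_coords g h (hZ i) hτ, chartLieInner,
    chartLie_sum s hZ τ (coords_mem_target y), matrixInner, Finset.mul_sum, Finset.sum_mul,
    Matrix.trace_sum]

theorem VecField.ChartC1.smul {Z : VecField n M} (hZ : Z.ChartC1) {f : M → ℝ}
    (hf : ContMDiff 𝓘(ℝ, Model n) 𝓘(ℝ, ℝ) 1 f) : VecField.ChartC1 fun y => f y • Z y := fun x => by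
  have h1 := contMDiffOn_iff_contDiffOn.mp
    (hf.comp_contMDiffOn (contMDiffOn_extChartAt_symm (I := 𝓘(ℝ, Model n)) (n := 1) x))
  refine (h1.smul (hZ x)).congr fun p hp => ?_
  ext i
  exact (coordCovec x (point x p) i).map_smul _ _

variable [MeasurableSpace M] [BorelSpace M]

theorem integrable_tensorInner_lieDeriv [CompactSpace M] {g : BilinField n M}
    (hg : g.IsChartMetric) {X : VecField n M} {τ h : BilinField n M} (hX : X.ChartC1)
    (hτ : τ.ChartC1) (hh : h.ChartC1) :
    Integrable (fun y => tensorInner g (lieDeriv X τ) h y) (riemannianVolume g) := by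
  have := isLocallyFiniteMeasure_riemannianVolume hg.chartC1
  exact (continuous_tensorInner_lieDeriv hg hX hτ hh).integrable_of_hasCompactSupport
    (HasCompactSupport.of_compactSpace _)

/-- The divergence theorem for vector fields supported in the domain of a chart. Note that
`⟨L_Z g, g⟩ = 2 div Z`. -/
theorem integral_tensorInner_lieDeriv_self_of_support {g : BilinField n M} (hg : g.IsChartMetric)
    {Z : VecField n M} (hZ : Z.ChartC1) (x : M) {K : Set M} (hK : IsCompact K) (hKc : IsClosed K)
    (hKx : K ⊆ (extChartAt 𝓘(ℝ, Model n) x).source) (hZK : ∀ y, y ∉ K → Z y = 0) :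
    ∫ y, tensorInner g (lieDeriv Z g) g y ∂(riemannianVolume g) = 0 := by
  have hto := isOpen_extChartAt_target (I := 𝓘(ℝ, Model n)) x
  have hzero : ∀ y, y ∉ K → tensorInner g (lieDeriv Z g) g y = 0 := fun y hy => by
    have hev : vecComps Z y =ᶠ[𝓝 (coords y)] fun _ => 0 := by
      have h1 : ContinuousAt (point y) (coords y : Model n) :=
        (continuousOn_extChartAt_symm y).continuousAt (extChartAt_target_mem_nhds y)
      have h2 : point y (coords y : Model n) ∈ Kᶜ := by
        have : point y (coords y : Model n) = y := point_extChartAt (n := n) (mem_extChartAt_source y)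
        rwa [this]
      filter_upwards [h1.eventually (hKc.isOpen_compl.mem_nhds h2)] with q hq
      ext i
      rw [vecComps, hZK _ hq, map_zero]
      rfl
    have h3 : vecComps Z y (coords y) = 0 := hev.self_of_nhds
    have h4 : jacobian (vecComps Z y) (coords y) = 0 := by
      ext a i
      rw [jacobian, hev.fderiv_eq]
      simp
    rw [tensorInner_lieDeriv_eq_coords g g hZ hg.chartC1, chartLieInner, chartLie, h3, h4,
      lieMatrix]
    simp [matrixInner]
  have hcont := continuous_tensorInner_lieDeriv hg hZ hg.chartC1 hg.chartC1
  rw [← setIntegral_eq_integral_of_forall_compl_eq_zero fun y hy => hzero y fun h => hy (hKx h),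
    setIntegral_riemannianVolume hg.chartC1 x hcont]
  classical
  -- `√(det g) Z` extended by zero to `ℝⁿ`. It is C¹ across the boundary of the chart image because
  -- its support lies in the compact image of `K`, inside the open target.
  set W : Model n → Fin n → ℝ := fun p => if p ∈ (extChartAt 𝓘(ℝ, Model n) x).target then
    density g x p • vecComps Z x p else 0 with hW
  have hWin : ∀ p ∈ (extChartAt 𝓘(ℝ, Model n) x).target,
      W =ᶠ[𝓝 p] fun q => density g x q • vecComps Z x q := fun p hp =>
    eventually_of_mem (hto.mem_nhds hp) fun q hq => if_pos hq
  have hK' : IsCompact (extChartAt 𝓘(ℝ, Model n) x '' K) :=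
    hK.image_of_continuousOn ((continuousOn_extChartAt x).mono hKx)
  have hW0 : ∀ p, p ∉ extChartAt 𝓘(ℝ, Model n) x '' K → W p = 0 := fun p hp => by
    by_cases hpt : p ∈ (extChartAt 𝓘(ℝ, Model n) x).target
    · have : point x p ∉ K := fun h => hp ⟨_, h, (extChartAt 𝓘(ℝ, Model n) x).right_inv hpt⟩
      have h3 : vecComps Z x p = 0 := by
        ext i
        rw [vecComps, hZK _ this, map_zero]
        rfl
      simp only [hW, h3, smul_zero, ite_self]
    · exact if_neg hpt
  have hdens : ∀ p ∈ (extChartAt 𝓘(ℝ, Model n) x).target, ContDiffAt ℝ 1 (density g x) p :=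
    fun p hp => (contDiff_det.contDiffAt.comp p (hg.chartC1.contDiffAt hp)).sqrt
      (hg.det_pos x p hp).ne'
  have hout : ∀ p, p ∉ (extChartAt 𝓘(ℝ, Model n) x).target → W =ᶠ[𝓝 p] fun _ => 0 := fun p hp => by
    refine eventually_of_mem (hK'.isClosed.isOpen_compl.mem_nhds ?_) hW0
    rintro ⟨y, hy, rfl⟩
    exact hp ((extChartAt 𝓘(ℝ, Model n) x).map_source (hKx hy))
  have hWc : ContDiff ℝ 1 W := contDiff_iff_contDiffAt.mpr fun p => by
    by_cases hp : p ∈ (extChartAt 𝓘(ℝ, Model n) x).target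
    · exact ((hdens p hp).smul (hZ.contDiffAt hp)).congr_of_eventuallyEq (hWin p hp)
    · exact contDiffAt_const.congr_of_eventuallyEq (hout p hp)
  have hWs : HasCompactSupport W := HasCompactSupport.intro hK' hW0
  have hdiv := integral_sum_fderiv_eq_zero hWc hWs
  rw [← setIntegral_eq_integral_of_forall_compl_eq_zero
    (s := (extChartAt 𝓘(ℝ, Model n) x).target)] at hdiv
  · have h5 : ∀ p ∈ (extChartAt 𝓘(ℝ, Model n) x).target,
        density g x p * tensorInner g (lieDeriv Z g) g (point x p) =
          2 * ∑ k, fderiv ℝ (fun q => W q k) p (stdVec k) := fun p hp => by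
      have h6 : ∀ k, (fun q => W q k) =ᶠ[𝓝 p] fun q => density g x q * vecComps Z x q k :=
        fun k => (hWin p hp).mono fun q hq => congrFun hq k
      have h7 : extChartAt 𝓘(ℝ, Model n) x (point x p) = p :=
        (extChartAt 𝓘(ℝ, Model n) x).right_inv hp
      rw [tensorInner_lieDeriv_eq g g hZ hg.chartC1 (mapsTo_point x hp), h7]
      have h8 := sum_fderiv_sqrt_det_mul ((hg.chartC1.contDiffAt hp).differentiableAt (by norm_num))
        ((hZ.contDiffAt hp).differentiableAt (by norm_num)) (hg.det_pos x p hp) (hg.symm.comps x p)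
      refine Eq.trans ?_ (congrArg (fun r : ℝ => 2 * r) (h8.symm.trans
        (Finset.sum_congr rfl fun k _ => by rw [(h6 k).fderiv_eq]; rfl)))
      rw [chartLieInner, chartLie, density]
      ring
    rw [setIntegral_congr_fun hto.measurableSet h5, integral_const_mul, hdiv, mul_zero]
  · intro p hp
    refine Finset.sum_eq_zero fun k _ => ?_
    have h6 : (fun q => W q k) =ᶠ[𝓝 p] fun _ => (0 : ℝ) :=
      (hout p hp).mono fun q hq => congrFun hq k
    rw [h6.fderiv_eq]
    simp

/-- The divergence theorem on a closed manifold. Note that `⟨L_Z g, g⟩ = 2 div Z`. -/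
theorem integral_tensorInner_lieDeriv_self [T2Space M] [CompactSpace M] {g : BilinField n M}
    (hg : g.IsChartMetric) {Z : VecField n M} (hZ : Z.ChartC1) :
    ∫ y, tensorInner g (lieDeriv Z g) g y ∂(riemannianVolume g) = 0 := by
  -- Finitely many charts, so that the partition of unity has a finite index type and its sum
  -- commutes with the integral.
  obtain ⟨t, ht⟩ := isCompact_univ.elim_finite_subcover
    (fun x : M => (extChartAt 𝓘(ℝ, Model n) x).source) (fun x => isOpen_extChartAt_source x)
    fun x _ => mem_iUnion.mpr ⟨x, mem_extChartAt_source x⟩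
  obtain ⟨f, hf⟩ := SmoothPartitionOfUnity.exists_isSubordinate 𝓘(ℝ, Model n)
    (isClosed_univ (X := M)) (fun i : t => (extChartAt 𝓘(ℝ, Model n) (i : M)).source)
    (fun i => isOpen_extChartAt_source _) (by
      refine ht.trans fun y hy => ?_
      obtain ⟨i, hi, hyi⟩ := mem_iUnion₂.mp hy
      exact mem_iUnion.mpr ⟨⟨i, hi⟩, hyi⟩)
  have hfZ : ∀ i, VecField.ChartC1 fun y => f i y • Z y := fun i =>
    hZ.smul ((f i).contMDiff.of_le (by exact_mod_cast le_top))
  have hsum : (fun y => ∑ i, f i y • Z y) = Z := funext fun y => by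
    have h1 := f.sum_eq_one (mem_univ y)
    rw [finsum_eq_sum_of_fintype] at h1
    rw [← Finset.sum_smul, h1, one_smul]
  have h2 : ∀ y, tensorInner g (lieDeriv Z g) g y =
      ∑ i, tensorInner g (lieDeriv (fun y => f i y • Z y) g) g y := fun y => by
    have := tensorInner_lieDeriv_sum Finset.univ g hfZ (by rw [hsum]; exact hZ) hg.chartC1 g y
    rwa [hsum] at this
  simp only [h2]
  rw [integral_finsetSum _ fun i _ =>
    integrable_tensorInner_lieDeriv hg (hfZ i) hg.chartC1 hg.chartC1]
  refine Finset.sum_eq_zero fun i _ => ?_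
  refine integral_tensorInner_lieDeriv_self_of_support hg (hfZ i) i
    (isClosed_tsupport (f i)).isCompact (isClosed_tsupport (f i)) (hf i) fun y hy => ?_
  rw [image_eq_zero_of_notMem_tsupport hy, zero_smul]

end DivergenceTheorem

/-! ### The flux field on the manifold and the pointwise identity. -/

section Flux

variable {n : ℕ} {M : Type*} [TopologicalSpace M] [ChartedSpace (Model n) M]
  [IsManifold 𝓘(ℝ, Model n) ∞ M]

open scoped Matrix.Norms.Operator

/-- The vector field `⟨τ, h⟩ X + 2 KSX - tr(K) SX`, where `S` and `K` are the endomorphisms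
associated with `τ` and `h` by the metric `g`. -/
def fluxField (g τ h : BilinField n M) (X : VecField n M) : VecField n M := fun y =>
  ∑ k, fluxVec (comps g y (coords y))⁻¹ (comps τ y (coords y)) (comps h y (coords y))
    (vecComps X y (coords y)) k • coordVec y y k

/-- The field is defined at each point in that point's own chart; `fluxVec_congruence` shows that
the same formula holds throughout any chart, which is what makes the field C¹. -/
theorem vecComps_fluxField (g τ h : BilinField n M) (X : VecField n M) {x : M} {p : Model n}
    (hp : p ∈ (extChartAt 𝓘(ℝ, Model n) x).target) :
    vecComps (fluxField g τ h X) x p =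
      fluxVec (comps g x p)⁻¹ (comps τ x p) (comps h x p) (vecComps X x p) := by
  obtain ⟨y, hy, rfl⟩ : ∃ y, y ∈ (extChartAt 𝓘(ℝ, Model n) x).source ∧
      p = extChartAt 𝓘(ℝ, Model n) x y :=
    ⟨point x p, mapsTo_point x hp, ((extChartAt 𝓘(ℝ, Model n) x).right_inv hp).symm⟩
  have hyy := mem_extChartAt_source (I := 𝓘(ℝ, Model n)) y
  have h1 : vecComps (fluxField g τ h X) y (extChartAt 𝓘(ℝ, Model n) y y) =
      fluxVec (comps g y (coords y))⁻¹ (comps τ y (coords y)) (comps h y (coords y))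
        (vecComps X y (coords y)) := by
    ext i
    rw [vecComps_extChartAt _ hyy]
    simp only [fluxField, map_sum, map_smul, coordCovec_coordVec hyy, smul_eq_mul]
    simp
  rw [vecComps_transition _ hyy hy, vecComps_transition X hyy hy, h1, coords,
    comps_transition g hyy hy, comps_transition τ hyy hy, comps_transition h hyy hy,
    inv_congruence, fluxVec_congruence (isUnit_det_transitionMatrix hyy hy)]

theorem chartC1_fluxField {g τ h : BilinField n M} {X : VecField n M} (hg : g.IsChartMetric)
    (hτ : τ.ChartC1) (hh : h.ChartC1) (hX : X.ChartC1) : (fluxField g τ h X).ChartC1 :=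
  fun _ _ hp => ((contDiffAt_fluxVec (hg.chartC1.contDiffAt hp) (hg.isUnit_det hp)
    (hτ.contDiffAt hp) (hh.contDiffAt hp) (hX.contDiffAt hp)).contDiffWithinAt).congr
    (fun _ hq => vecComps_fluxField g τ h X hq) (vecComps_fluxField g τ h X hp)

theorem jacobian_fluxField {g τ h : BilinField n M} {X : VecField n M} (hg : g.IsChartMetric)
    (hτ : τ.ChartC1) (hh : h.ChartC1) (hX : X.ChartC1) {x : M} {p : Model n}
    (hp : p ∈ (extChartAt 𝓘(ℝ, Model n) x).target) :
    jacobian (vecComps (fluxField g τ h X) x) p = Matrix.of fun a k =>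
      fluxVecDeriv (comps g x p)⁻¹ (fderiv ℝ (comps g x) p (stdVec k)) (comps τ x p)
        (fderiv ℝ (comps τ x) p (stdVec k)) (comps h x p) (fderiv ℝ (comps h x) p (stdVec k))
        (vecComps X x p) (fun i => jacobian (vecComps X x) p i k) a := by
  have hev : vecComps (fluxField g τ h X) x =ᶠ[𝓝 p] fun q =>
      fluxVec (comps g x q)⁻¹ (comps τ x q) (comps h x q) (vecComps X x q) :=
    eventually_of_mem ((isOpen_extChartAt_target x).mem_nhds hp)
      fun q hq => vecComps_fluxField g τ h X hq
  have hd := contDiffAt_fluxVec (hg.chartC1.contDiffAt hp) (hg.isUnit_det hp)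
    (hτ.contDiffAt hp) (hh.contDiffAt hp) (hX.contDiffAt hp)
  have h1 : ∀ k, fderiv ℝ (vecComps (fluxField g τ h X) x) p (stdVec k) =
      fluxVecDeriv (comps g x p)⁻¹ (fderiv ℝ (comps g x) p (stdVec k)) (comps τ x p)
        (fderiv ℝ (comps τ x) p (stdVec k)) (comps h x p) (fderiv ℝ (comps h x) p (stdVec k))
        (vecComps X x p) (fderiv ℝ (vecComps X x) p (stdVec k)) := fun k => by
    have h2 := (hd.differentiableAt (by norm_num)).hasFDerivAt.hasLineDerivAt (stdVec k)
    have h3 := hasDerivAt_fluxVec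
      (((hg.chartC1.contDiffAt hp).differentiableAt (by norm_num)).hasFDerivAt.hasLineDerivAt
        (stdVec k)) (by simpa using hg.isUnit_det hp)
      (((hτ.contDiffAt hp).differentiableAt (by norm_num)).hasFDerivAt.hasLineDerivAt (stdVec k))
      (((hh.contDiffAt hp).differentiableAt (by norm_num)).hasFDerivAt.hasLineDerivAt (stdVec k))
      (((hX.contDiffAt hp).differentiableAt (by norm_num)).hasFDerivAt.hasLineDerivAt (stdVec k))
    rw [hev.fderiv_eq]
    refine (h2.unique h3).trans ?_
    simp only [zero_smul, add_zero]
    rfl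
  ext a k
  exact congrFun (h1 k) a

theorem divergence_eq_divergenceForm {g τ : BilinField n M} (hg : g.ChartC1) (hgs : g.IsSymm)
    (hτ : τ.ChartC1) (hτs : τ.IsSymm) (x : M) (v : Tan n x) :
    divergence g τ x v = divergenceForm (comps g x (coords x))⁻¹
      (fun k => fderiv ℝ (comps g x) (coords x) (stdVec k)) (comps τ x (coords x))
      (fun k => fderiv ℝ (comps τ x) (coords x) (stdVec k)) (fun j => coordCovec x x j v) := by
  have hgd := (hg.contDiffAt (coords_mem_target x)).differentiableAt (by norm_num)
  have hτd := (hτ.contDiffAt (coords_mem_target x)).differentiableAt (by norm_num)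
  have hP : (comps g x (coords x))⁻¹.IsSymm := by
    rw [Matrix.IsSymm, Matrix.transpose_nonsing_inv, hgs.comps]
  have hG : ∀ k, (fderiv ℝ (comps g x) (coords x) (stdVec k)).IsSymm := fun k => by
    ext i j
    rw [Matrix.transpose_apply, ← fderiv_matrix_entry hgd, ← fderiv_matrix_entry hgd]
    have : (fun q => comps g x q j i) = fun q => comps g x q i j :=
      funext fun q => (hgs.comps x q).apply i j
    rw [this]
  rw [← sum_divergence_eq_divergenceForm hP (hτs.comps x _) hG]
  simp only [divergence, _root_.sum_apply, _root_.smul_apply, smul_eq_mul, divergenceComps,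
    covDerivComps, christoffel, partialDeriv, fderiv_matrix_entry hgd, fderiv_matrix_entry hτd,
    christoffelSymbol]

theorem comps_add_smul (g h : BilinField n M) (s : ℝ) (x : M) :
    comps (fun y => g y + s • h y) x = fun p => comps g x p + s • comps h x p := by
  ext p i j
  simp [comps]

theorem BilinField.ChartC1.add_smul {g h : BilinField n M} (hg : g.ChartC1) (hh : h.ChartC1)
    (s : ℝ) : BilinField.ChartC1 fun y => g y + s • h y := fun x => by
  rw [comps_add_smul]
  exact (hg x).add ((hh x).const_smul s)

/-- The variation of the divergence of a symmetric bilinear form. -/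
theorem hasDerivAt_divergence {g h τ : BilinField n M} (hg : g.IsChartMetric) (hh : h.ChartC1)
    (hhs : h.IsSymm) (hτ : τ.ChartC1) (hτs : τ.IsSymm) (x : M) (v : Tan n x) :
    HasDerivAt (fun s : ℝ => divergence (fun y => g y + s • h y) τ x v)
      (divergenceFormDeriv (comps g x (coords x))⁻¹
        (fun k => fderiv ℝ (comps g x) (coords x) (stdVec k)) (comps h x (coords x))
        (fun k => fderiv ℝ (comps h x) (coords x) (stdVec k)) (comps τ x (coords x))
        (fun k => fderiv ℝ (comps τ x) (coords x) (stdVec k)) (fun j => coordCovec x x j v)) 0 := by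
  have hgd := (hg.chartC1.contDiffAt (coords_mem_target x)).differentiableAt (by norm_num)
  have hhd := (hh.contDiffAt (coords_mem_target x)).differentiableAt (by norm_num)
  have h1 := hasDerivAt_divergenceForm (H := comps h x (coords x)) (T := comps τ x (coords x))
    (Gk := fun k => fderiv ℝ (comps g x) (coords x) (stdVec k))
    (Hk := fun k => fderiv ℝ (comps h x) (coords x) (stdVec k))
    (Tk := fun k => fderiv ℝ (comps τ x) (coords x) (stdVec k))
    (hg.isUnit_det (coords_mem_target x)) (fun j => coordCovec x x j v)
  -- The formula holds for every `s`, even where `g + s h` degenerates: it uses only symmetry of the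
  -- matrix inverse, which persists for the default inverse `0`.
  refine h1.congr_of_eventuallyEq (Eventually.of_forall fun s => ?_)
  have hs : BilinField.IsSymm (M := M) fun y => g y + s • h y := fun y u w => by
    simp [hg.symm y u w, hhs y u w]
  have h2 : fderiv ℝ (comps (fun y => g y + s • h y) x) (coords x) =
      fderiv ℝ (comps g x) (coords x) + s • fderiv ℝ (comps h x) (coords x) := by
    rw [comps_add_smul]
    exact (hgd.hasFDerivAt.add (hhd.hasFDerivAt.const_smul s)).fderiv
  dsimp only
  rw [divergence_eq_divergenceForm (hg.chartC1.add_smul hh s) hs hτ hτs, h2, comps_add_smul]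
  rfl

/-- For a Killing field `X` and a divergence-free `τ`, twice the divergence of the flux field is
`2 (⟨L_X τ, h⟩ + 2 ⟨δ'_h τ, X⟩)`. -/
theorem tensorInner_lieDeriv_fluxField {g h τ : BilinField n M} {X : VecField n M}
    (hg : g.IsChartMetric) (hX : X.ChartC1) (hKilling : IsKilling g X) (hh : h.ChartC1)
    (hhs : h.IsSymm) (hτ : τ.ChartC1) (hτs : τ.IsSymm) (hdiv : IsDivFree g τ) (x : M) :
    tensorInner g (lieDeriv (fluxField g τ h X) g) g x =
      2 * (tensorInner g (lieDeriv X τ) h x + 2 * divVariation g h τ x (X x)) := by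
  have hx := coords_mem_target (n := n) x
  have hv : vecComps X x (coords x) = fun j => coordCovec x x j (X x) :=
    funext fun j => vecComps_extChartAt X (mem_extChartAt_source x) j
  have hP : (comps g x (coords x))⁻¹.IsSymm := by
    rw [Matrix.IsSymm, Matrix.transpose_nonsing_inv, hg.symm.comps]
  have h1 : divergenceForm (comps g x (coords x))⁻¹
      (fun k => fderiv ℝ (comps g x) (coords x) (stdVec k)) (comps τ x (coords x))
      (fun k => fderiv ℝ (comps τ x) (coords x) (stdVec k)) (vecComps X x (coords x)) = 0 := by
    rw [hv, ← divergence_eq_divergenceForm hg.chartC1 hg.symm hτ hτs, hdiv x]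
    rfl
  have h2 : chartLie X g x (coords x) = 0 := by
    rw [← comps_lieDeriv hX hg.chartC1]
    have : point x (coords x : Model n) = x := point_extChartAt (n := n) (mem_extChartAt_source x)
    ext i j
    rw [comps, this, hKilling x]
    rfl
  rw [divVariation, (hasDerivAt_divergence hg hh hhs hτ hτs x (X x)).deriv,
    tensorInner_lieDeriv_eq_coords g h hX hτ,
    tensorInner_lieDeriv_eq_coords g g (chartC1_fluxField hg hτ hh hX) hg.chartC1, chartLieInner,
    chartLieInner, chartLie, jacobian_fluxField hg hτ hh hX hx, vecComps_fluxField g τ h X hx, ← hv]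
  exact matrixInner_lieMatrix_fluxVec (hg.symm.comps x _) hP (hτs.comps x _) (hhs.comps x _)
    (Matrix.nonsing_inv_mul _ (hg.isUnit_det hx)) h1 h2

end Flux

end ClosedRiemannian

end

theorem proposition4p1 (n : ℕ) (M : Type*) [TopologicalSpace M] [T2Space M] [CompactSpace M]
    [ChartedSpace (ClosedRiemannian.Model n) M]
    [IsManifold 𝓘(ℝ, ClosedRiemannian.Model n) ∞ M]
    [MeasurableSpace M] [BorelSpace M]
    (γ : ClosedRiemannian.Metric n M)
    (X : ClosedRiemannian.VecField n M) (hX : X.IsC1)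
    (hKilling : ClosedRiemannian.IsKilling γ.inner X)
    (τ : ClosedRiemannian.BilinField n M) (hτ : τ.IsC1) (hτsymm : τ.IsSymm)
    (hτdiv : ClosedRiemannian.IsDivFree γ.inner τ)
    (h : ClosedRiemannian.BilinField n M) (hh : h.IsC1) (hhsymm : h.IsSymm) :
    -- the variation of the divergence exists at each point
    (∀ (x : M) (v : ClosedRiemannian.Tan n x), DifferentiableAt ℝ
      (fun s : ℝ => ClosedRiemannian.divergence (fun y => γ.inner y + s • h y) τ x v) 0) ∧
    Integrable (fun x => ClosedRiemannian.tensorInner γ.inner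
      (ClosedRiemannian.lieDeriv X τ) h x) (ClosedRiemannian.riemannianVolume γ.inner) ∧
    Integrable (fun x => ClosedRiemannian.divVariation γ.inner h τ x (X x))
      (ClosedRiemannian.riemannianVolume γ.inner) ∧
    ∫ x, ClosedRiemannian.tensorInner γ.inner (ClosedRiemannian.lieDeriv X τ) h x
        ∂(ClosedRiemannian.riemannianVolume γ.inner) =
      -2 * ∫ x, ClosedRiemannian.divVariation γ.inner h τ x (X x)
        ∂(ClosedRiemannian.riemannianVolume γ.inner) := by
  have hg := ClosedRiemannian.Metric.isChartMetric γ
  have hX' := hX.chartC1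
  have hτ' := hτ.chartC1
  have hh' := hh.chartC1
  have hF := ClosedRiemannian.chartC1_fluxField hg hτ' hh' hX'
  have hI := ClosedRiemannian.integrable_tensorInner_lieDeriv hg hX' hτ' hh'
  have hJ := ClosedRiemannian.integrable_tensorInner_lieDeriv hg hF hg.chartC1 hg.chartC1
  have hdiv := ClosedRiemannian.integral_tensorInner_lieDeriv_self hg hF
  -- The pointwise identity solved for the variation. Both terms on the right are integrable, so the
  -- variation is too, and the first integrates to zero by the divergence theorem.
  have hvar : (fun x => ClosedRiemannian.divVariation γ.inner h τ x (X x)) = fun x =>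
      (1 / 4 : ℝ) * ClosedRiemannian.tensorInner γ.inner (ClosedRiemannian.lieDeriv
        (ClosedRiemannian.fluxField γ.inner τ h X) γ.inner) γ.inner x -
      (1 / 2 : ℝ) * ClosedRiemannian.tensorInner γ.inner (ClosedRiemannian.lieDeriv X τ) h x :=
    funext fun x => by
      rw [ClosedRiemannian.tensorInner_lieDeriv_fluxField hg hX' hKilling hh' hhsymm hτ'
        hτsymm hτdiv]
      ring
  refine ⟨fun x v => (ClosedRiemannian.hasDerivAt_divergence hg hh' hhsymm hτ' hτsymm x
    v).differentiableAt, hI, ?_, ?_⟩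
  · rw [hvar]
    exact (hJ.const_mul _).sub (hI.const_mul _)
  · rw [hvar, integral_sub (hJ.const_mul _) (hI.const_mul _), integral_const_mul,
      integral_const_mul, hdiv]
    ring
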